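/- Let $K_{\mathbb N}$ be the complete graph on a countably infinite vertex set. For graphs $G$ and $H$, consider the following game between Builder and Painter on $K_{\mathbb N}$: in each round Builder chooses an edge and Painter colours it red or blue (if Builder chooses an edge that was chosen before, the round counts but the colour of the edge does not change). Builder wins as soon as there is a red copy of $G$ or a blue copy of $H$ (a copy being a not necessarily induced subgraph isomorphic to the given graph). The on-line Ramsey number $\tilde r(G,H)$ is the least number $n$ such that Builder can guarantee to win within $n$ rounds, whatever Painter does. Let $P_s$ denote the path on $s$ vertices. Theorem. For all integers $\ell\ge 3$, the number $\tilde r(P_4,P_{\ell+1})$ is finite and $$\frac{7\ell+2}{5}\;\le\;\tilde r(P_4,P_{\ell+1})\;\le\;\frac{7\ell+52}{5}.$$ -/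

import Mathlib

namespace OnlineRamsey

/-- A position of the game on the edge set of the infinite clique with vertex set `ℕ`: the graph
of the uncovered edges coloured red and the graph of the uncovered edges coloured blue. -/
structure Position where
  red : SimpleGraph ℕ
  blue : SimpleGraph ℕ

namespace Position

/-- The initial position, where no edge has been chosen. -/
def start : Position := ⟨⊥, ⊥⟩

/-- The edge `uv` has already been chosen by Builder. -/
def Uncovered (X : Position) (u v : ℕ) : Prop := X.red.Adj u v ∨ X.blue.Adj u v

/-- The position after Painter colours the edge `uv` red. -/
def paintRed (X : Position) (u v : ℕ) : Position := ⟨X.red ⊔ SimpleGraph.edge u v, X.blue⟩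

/-- The position after Painter colours the edge `uv` blue. -/
def paintBlue (X : Position) (u v : ℕ) : Position := ⟨X.red, X.blue ⊔ SimpleGraph.edge u v⟩

end Position

variable {V W : Type*}

/-- There is a red copy of `G` or a blue copy of `H` (copies need not be induced). -/
def Won (G : SimpleGraph V) (H : SimpleGraph W) (X : Position) : Prop :=
  G.IsContained X.red ∨ H.IsContained X.blue

/-- From position `X`, Builder can be sure to win within at most `n` further rounds, whatever
Painter does. In a round Builder chooses an edge `uv` of the infinite clique. If it is new, then
Painter colours it red or blue; if it has been chosen before, then the round is wasted: it counts,
but the position does not change. -/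
def BuilderWinsWithin (G : SimpleGraph V) (H : SimpleGraph W) : ℕ → Position → Prop
  | 0, X => Won G H X
  | n + 1, X => Won G H X ∨ ∃ u v : ℕ, u ≠ v ∧
      (X.Uncovered u v → BuilderWinsWithin G H n X) ∧
      (¬ X.Uncovered u v → BuilderWinsWithin G H n (X.paintRed u v) ∧
        BuilderWinsWithin G H n (X.paintBlue u v))

/-- The on-line Ramsey number of `G` (red) and `H` (blue): the least number of rounds within which
Builder can be sure to win the game (`⊤` if there is none). -/
noncomputable def onlineRamseyNumber (G : SimpleGraph V) (H : SimpleGraph W) : ℕ∞ :=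
  ⨅ (n : ℕ) (_ : BuilderWinsWithin G H n Position.start), (n : ℕ∞)

end OnlineRamsey

namespace OnlineRamsey

open SimpleGraph

/-! Lower bound. Painter colours an edge red exactly when one end has no red edge yet and the other
is not a leaf of a red star with at least two edges. All red components are then stars, so no red
`P₄` appears, and a vertex without red edges has blue edges only to such leaves. Hence on a blue
path the vertices without red edges are no more numerous than the leaves, up to one that a centre
absorbs. A star with `k ≥ 2` edges thus accounts for at most `2k + 1 ≤ 5k/2` path vertices and a
single red edge for two, so `ℓ + 1` vertices need at least `2(ℓ + 1)/5` red edges besides the `ℓ`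
blue ones (`StarInvariant.of_blue_path`).

Upper bound. Two configurations force blue edges: an end of a red path with two edges towards any
vertex without red edges (`RedLeaf.redLoses`), and a vertex of a new red component towards all older
components (`redLoses_of_new`). Ideally two red edges at a new vertex and five forced blue edges put
five new vertices on blue paths: seven rounds for five vertices. When Painter deviates, Builder is
left with several blue paths, and the loss is controlled by a potential. In tenths of a round, each
collected vertex earns 14, while an open path with two isolated ends owes 16, one with a single
isolated end owes 13, a spare leaf 4, and a nonempty chain `C` 10. Every turn of
`StockWins.of_single`, `StockWins.of_double` and `StockWins.of_growing` respects this account, and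
the constant 80 pays for joining the paths at the end. The induction is closed in `stockWins`. -/

/-! ### Paths as lists of vertices. -/

theorem pathGraph_isContained_of_isChain {G : SimpleGraph ℕ} {p : List ℕ}
    (hc : p.IsChain G.Adj) (hn : p.Nodup) {n : ℕ} (h : n ≤ p.length) :
    (pathGraph n).IsContained G := by
  have key : ∀ i : ℕ, ∀ hi : i + 1 < p.length, G.Adj p[i] p[i + 1] :=
    fun i hi => List.isChain_iff_getElem.1 hc i hi
  refine ⟨⟨⟨fun i : Fin n => p[i.1]'(by omega), ?_⟩, ?_⟩⟩
  · intro i j hij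
    rw [pathGraph_adj] at hij
    rcases hij with hij | hij
    · have := key i.1 (by omega)
      simpa only [hij] using this
    · have := key j.1 (by omega)
      simpa only [hij] using this.symm
  · intro i j hij
    have := (List.Nodup.getElem_inj_iff hn).1 hij
    exact Fin.ext this

theorem exists_isChain_of_pathGraph_isContained {G : SimpleGraph ℕ} {n : ℕ}
    (h : (pathGraph n).IsContained G) :
    ∃ p : List ℕ, p.IsChain G.Adj ∧ p.Nodup ∧ p.length = n := by
  obtain ⟨f⟩ := h
  refine ⟨List.ofFn f, ?_, ?_, by simp⟩
  · rw [List.isChain_iff_getElem]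
    intro i hi
    simp only [List.length_ofFn] at hi
    simp only [List.getElem_ofFn]
    apply f.toHom.map_adj
    rw [pathGraph_adj]
    simp
  · exact List.nodup_ofFn.2 f.injective

/-! ### Lower bound: Painter keeps the red components stars. -/

/-- Painter's bookkeeping in the lower bound: `K` is the set of vertices of the red components
with one edge, `Ce` and `Le` are the sets of centres and of leaves of the larger red stars, `R`
counts the red edges and `B` bounds the number of blue edges. -/
structure StarInvariant (X : Position) (K Ce Le : Finset ℕ) (R B : ℕ) : Prop where
  disj_K_Ce : ∀ v ∈ K, v ∉ Ce
  disj_K_Le : ∀ v ∈ K, v ∉ Le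
  disj_Ce_Le : ∀ v ∈ Ce, v ∉ Le
  red_edge : ∀ u v, X.red.Adj u v → (u ∈ K ∧ v ∈ K) ∨ (u ∈ Ce ∧ v ∈ Le) ∨ (u ∈ Le ∧ v ∈ Ce)
  unique : ∀ u v w, u ∉ Ce → X.red.Adj u v → X.red.Adj u w → v = w
  partner : ∀ u ∈ K, ∃ v, X.red.Adj u v
  blue_edge : ∀ u v, X.blue.Adj u v → u ∉ K → u ∉ Ce → u ∉ Le → v ∈ Le
  weight : 8 * Le.card + 4 * Ce.card + 5 * K.card ≤ 10 * R
  centre : Le.Nonempty → Ce.Nonempty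
  blue_card : X.blue.edgeSet.encard ≤ B

theorem StarInvariant.no_red_path {X : Position} {K Ce Le : Finset ℕ} {R B : ℕ}
    (h : StarInvariant X K Ce Le R B) : ¬ (pathGraph 4).IsContained X.red := by
  intro hc
  obtain ⟨p, hp, hn, hl⟩ := exists_isChain_of_pathGraph_isContained hc
  obtain ⟨a, b, c, d, rfl⟩ : ∃ a b c d, p = [a, b, c, d] := by
    match p, hl with
    | [a, b, c, d], _ => exact ⟨a, b, c, d, rfl⟩
  simp at hp hn
  obtain ⟨hab, hbc, hcd⟩ := hp
  have hb : b ∈ Ce := by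
    by_contra hb
    have := h.unique b a c hb hab.symm hbc
    tauto
  have hc : c ∈ Ce := by
    by_contra hc
    have := h.unique c b d hc hbc.symm hcd
    tauto
  have h1 := h.disj_K_Ce b
  have h2 := h.disj_Ce_Le b hb
  have h3 := h.disj_Ce_Le c hc
  rcases h.red_edge b c hbc with h | h | h <;> tauto

/-- In a chain in which the neighbours of the elements outside `S` all lie in `Le ⊆ S`, the
elements outside `S` are not more frequent than those of `Le`, up to boundary effects. -/
theorem countP_compl_le {adj : ℕ → ℕ → Prop} (hs : ∀ u v, adj u v → adj v u) (S Le : Finset ℕ)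
    (hsub : Le ⊆ S) (hadj : ∀ u v, adj u v → u ∉ S → v ∈ Le) :
    ∀ p : List ℕ, p.IsChain adj →
      (p.countP (· ∉ S) ≤ p.countP (· ∈ Le) + 1) ∧
      ((∀ v ∈ p.head?, v ∈ S) → p.countP (· ∉ S) ≤ p.countP (· ∈ Le)) ∧
      ((∃ v ∈ p, v ∈ S ∧ v ∉ Le) → p.countP (· ∉ S) ≤ p.countP (· ∈ Le) ∧
        ((∀ v ∈ p.head?, v ∈ Le) → p.countP (· ∉ S) + 1 ≤ p.countP (· ∈ Le)))
  | [], _ => by simp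
  | [v], _ => by
    have := @hsub v
    by_cases h1 : v ∈ S <;> by_cases h2 : v ∈ Le <;> simp [h1, h2]
  -- If `v` lies outside `S`, then `w` lies in `Le`; the sharper bounds for a tail with head in `S`
  -- or in `Le` leave room to count `v`.
  | v :: w :: t, hc => by
    rw [List.isChain_cons_cons] at hc
    obtain ⟨i1, i2, i3⟩ := countP_compl_le hs S Le hsub hadj (w :: t) hc.2
    have e1 := hadj v w hc.1
    have e2 := hadj w v (hs _ _ hc.1)
    have hv := @hsub v
    have hw := @hsub w
    rw [List.countP_cons (a := v), List.countP_cons (a := v)]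
    generalize hA : (w :: t).countP (· ∉ S) = A at *
    generalize hL : (w :: t).countP (· ∈ Le) = L at *
    simp only [List.head?_cons, Option.mem_def, Option.some.injEq, forall_eq'] at *
    have i3' : (∃ x ∈ v :: w :: t, x ∈ S ∧ x ∉ Le) → (v ∈ S ∧ v ∉ Le) ∨
        (∃ x ∈ w :: t, x ∈ S ∧ x ∉ Le) := by
      rintro ⟨x, hx, hx'⟩
      rcases List.mem_cons.1 hx with rfl | hx
      · exact Or.inl hx'
      · exact Or.inr ⟨x, hx, hx'⟩
    generalize (∃ x ∈ w :: t, x ∈ S ∧ x ∉ Le) = Q at *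
    generalize (∃ x ∈ v :: w :: t, x ∈ S ∧ x ∉ Le) = Q' at *
    by_cases h1 : v ∈ S <;> by_cases h2 : v ∈ Le <;> by_cases h3 : w ∈ S <;>
      by_cases h4 : w ∈ Le <;> by_cases hq : Q <;> simp_all <;> omega

theorem exists_finset_edges {G : SimpleGraph ℕ} : ∀ {p : List ℕ}, p.IsChain G.Adj → p.Nodup →
    ∃ E : Finset (Sym2 ℕ), (E : Set (Sym2 ℕ)) ⊆ G.edgeSet ∧ p.length ≤ E.card + 1 ∧
      ∀ e ∈ E, ∀ v ∈ e, v ∈ p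
  | [], _, _ => ⟨∅, by simp⟩
  | [v], _, _ => ⟨∅, by simp⟩
  | v :: w :: t, hc, hn => by
    rw [List.isChain_cons_cons] at hc
    rw [List.nodup_cons] at hn
    obtain ⟨E, h1, h2, h3⟩ := exists_finset_edges hc.2 hn.2
    have hne : s(v, w) ∉ E := fun he => hn.1 (h3 _ he v (by simp))
    refine ⟨insert s(v, w) E, ?_, ?_, ?_⟩
    · rw [Finset.coe_insert, Set.insert_subset_iff]
      exact ⟨hc.1, h1⟩
    · rw [Finset.card_insert_of_notMem hne]
      simp only [List.length_cons] at *
      omega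
    · intro e he x hx
      rcases Finset.mem_insert.1 he with rfl | he
      · rcases Sym2.mem_iff.1 hx with rfl | rfl <;> simp
      · exact List.mem_cons_of_mem _ (h3 e he x hx)

theorem length_le_encard_edgeSet {G : SimpleGraph ℕ} {p : List ℕ} (hc : p.IsChain G.Adj)
    (hn : p.Nodup) : (p.length : ℕ∞) ≤ G.edgeSet.encard + 1 := by
  obtain ⟨E, h1, h2, -⟩ := exists_finset_edges hc hn
  calc (p.length : ℕ∞) ≤ (E.card : ℕ∞) + 1 := by exact_mod_cast h2
    _ = (E : Set (Sym2 ℕ)).encard + 1 := by rw [Set.encard_coe_eq_coe_finsetCard]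
    _ ≤ _ := by gcongr

theorem countP_le_card {p : List ℕ} (hn : p.Nodup) (S : Finset ℕ) (q : ℕ → Bool)
    (h : ∀ v ∈ p, q v → v ∈ S) : p.countP q ≤ S.card := by
  rw [List.countP_eq_length_filter, ← List.toFinset_card_of_nodup (hn.filter _)]
  apply Finset.card_le_card
  intro v hv
  simp only [List.mem_toFinset, List.mem_filter] at hv
  exact h v hv.1 hv.2

/-- Counting path vertices gives `ℓ + 1 ≤ 2|Le| + |Ce| + |K|`; with `weight` this yields `4(ℓ + 1) ≤
10R`, and `ℓ ≤ B` since the path itself is blue. -/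
theorem StarInvariant.of_blue_path {X : Position} {K Ce Le : Finset ℕ} {R B ℓ : ℕ}
    (h : StarInvariant X K Ce Le R B) (hℓ : 1 ≤ ℓ)
    (hw : (pathGraph (ℓ + 1)).IsContained X.blue) : 7 * ℓ + 2 ≤ 5 * (R + B) := by
  obtain ⟨p, hp, hn, hl⟩ := exists_isChain_of_pathGraph_isContained hw
  have hB : ℓ ≤ B := by
    have h1 := length_le_encard_edgeSet hp hn
    have h2 : (p.length : ℕ∞) ≤ (B : ℕ∞) + 1 := h1.trans (by gcongr; exact h.blue_card)
    have h3 : p.length ≤ B + 1 := by exact_mod_cast h2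
    omega
  set S := K ∪ Ce ∪ Le with hS
  have hadj : ∀ u v, X.blue.Adj u v → u ∉ S → v ∈ Le := by
    intro u v huv hu
    simp only [hS, Finset.mem_union, not_or] at hu
    exact h.blue_edge u v huv hu.1.1 hu.1.2 hu.2
  have hsub : Le ⊆ S := Finset.subset_union_right
  obtain ⟨c1, -, c3⟩ := countP_compl_le (fun u v => X.blue.symm.symm u v) S Le hsub hadj p hp
  have hL := countP_le_card hn Le (· ∈ Le) (by simp)
  have hO := countP_le_card hn (K ∪ Ce) (fun v => v ∈ S ∧ v ∉ Le) (by
    intro v _ hv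
    simp only [hS, Finset.mem_union, decide_eq_true_eq] at hv ⊢
    tauto)
  have hlen : p.length = p.countP (· ∉ S) + (p.countP (· ∈ Le) +
      p.countP (fun v => v ∈ S ∧ v ∉ Le)) := by
    clear hl hp hn c1 c3 hL hO
    induction p with
    | nil => simp
    | cons v t ih =>
      have := @hsub v
      rw [List.length_cons, ih]
      simp only [List.countP_cons]
      by_cases h1 : v ∈ S <;> by_cases h2 : v ∈ Le <;> simp_all <;> omega
  have hcard := Finset.card_union_le K Ce
  have hmain : ℓ + 1 ≤ 2 * Le.card + Ce.card + K.card := by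
    -- A path vertex in `K ∪ Ce` removes the boundary term of the count. Otherwise the path consists
    -- of leaves and outside vertices only, some leaf exists, and its centre, not on the path,
    -- absorbs the extra 1.
    by_cases hex : ∃ v ∈ p, v ∈ S ∧ v ∉ Le
    · have := (c3 hex).1
      omega
    · have h0 : p.countP (fun v => v ∈ S ∧ v ∉ Le) = 0 := by
        rw [List.countP_eq_zero]
        intro v hv hq
        exact hex ⟨v, hv, by simpa using hq⟩
      have hpos : 0 < Le.card := by
        omega
      have := (h.centre (Finset.card_pos.1 hpos)).card_pos
      omega
  have := h.weight
  omega

theorem StarInvariant.paintBlue {X : Position} {K Ce Le : Finset ℕ} {R B : ℕ}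
    (h : StarInvariant X K Ce Le R B) {u v : ℕ} (hu : u ∈ K ∪ Ce ∪ Le ∨ v ∈ Le)
    (hv : v ∈ K ∪ Ce ∪ Le ∨ u ∈ Le) :
    StarInvariant (X.paintBlue u v) K Ce Le R (B + 1) where
  __ := h
  blue_edge := by
    intro x y hxy
    simp only [Position.paintBlue, sup_adj, edge_adj] at hxy
    simp only [Finset.mem_union] at hu hv
    rcases hxy with hxy | ⟨⟨rfl, rfl⟩ | ⟨rfl, rfl⟩, -⟩
    · exact h.blue_edge x y hxy
    · tauto
    · tauto
  blue_card := by
    simp only [Position.paintBlue, edgeSet_sup]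
    refine (Set.encard_union_le _ _).trans ?_
    push_cast
    refine add_le_add h.blue_card ?_
    refine (Set.encard_le_encard (edgeSet_edge_subset)).trans ?_
    simp

/-- The other end `v` is a centre, lies in a one-edge component, or is isolated. The star gains a
leaf, or the component becomes a star with centre `v` and two leaves, or a new one-edge component
arises. The weighted sum grows by 8, by `4 + 16 - 10 = 10`, or by 10, within the 10 that the new red
edge contributes. -/
theorem StarInvariant.paintRed {X : Position} {K Ce Le : Finset ℕ} {R B : ℕ}
    (h : StarInvariant X K Ce Le R B) {u v : ℕ} (huv : u ≠ v) (hu : u ∉ K ∪ Ce ∪ Le)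
    (hv : v ∉ Le) : ∃ K' Ce' Le', StarInvariant (X.paintRed u v) K' Ce' Le' (R + 1) B := by
  simp only [Finset.mem_union, not_or] at hu
  obtain ⟨⟨huK, huC⟩, huL⟩ := hu
  have hiso : ∀ w, ¬ X.red.Adj u w := by
    intro w hw
    rcases h.red_edge u w hw with h | h | h <;> tauto
  have hadj : ∀ x y, (X.paintRed u v).red.Adj x y ↔
      X.red.Adj x y ∨ (x = u ∧ y = v) ∨ (x = v ∧ y = u) := by
    intro x y
    simp only [Position.paintRed, sup_adj, edge_adj]
    constructor
    · tauto
    · rintro (h | ⟨rfl, rfl⟩ | ⟨rfl, rfl⟩)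
      · exact Or.inl h
      · exact Or.inr ⟨Or.inl ⟨rfl, rfl⟩, huv⟩
      · exact Or.inr ⟨Or.inr ⟨rfl, rfl⟩, huv.symm⟩
  have hblue : (X.paintRed u v).blue = X.blue := rfl
  generalize X.paintRed u v = Y at hadj hblue
  obtain ⟨d1, d2, d3, hred, huniq, hpart, hbl, hwt, hcen, hcard⟩ := h
  have hsymm : ∀ x y, X.red.Adj x y → X.red.Adj y x := fun x y h => h.symm
  by_cases hvC : v ∈ Ce
  · have hvK : v ∉ K := fun h => d1 v h hvC
    refine ⟨K, Ce, insert u Le, ⟨?_, ?_, ?_, ?_, ?_, ?_, ?_, ?_, ?_, ?_⟩⟩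
    · grind
    · grind
    · grind
    · grind
    · grind
    · grind
    · grind
    · rw [Finset.card_insert_of_notMem huL]
      omega
    · exact fun _ => ⟨v, hvC⟩
    · rwa [hblue]
  by_cases hvK : v ∈ K
  · obtain ⟨w, hw⟩ := hpart v hvK
    have hwK : w ∈ K := by
      have := hred v w hw
      grind
    have hvw : v ≠ w := hw.ne
    refine ⟨(K.erase v).erase w, insert v Ce, insert u (insert w Le),
      ⟨?_, ?_, ?_, ?_, ?_, ?_, ?_, ?_, ?_, ?_⟩⟩
    · grind
    · grind
    · grind
    · intro x y hxy
      have h1 := hred x y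
      have h2 := huniq v w y
      have h3 := huniq w v y
      have h4 := huniq v w x
      have h5 := huniq w v x
      grind
    · grind
    · intro x hx
      obtain ⟨y, hy⟩ := hpart x (by grind)
      exact ⟨y, by grind⟩
    · grind
    · have hwL : w ∉ Le := d2 w hwK
      have hu' : u ∉ insert w Le := by grind
      rw [Finset.card_insert_of_notMem hu', Finset.card_insert_of_notMem hwL,
        Finset.card_insert_of_notMem hvC, Finset.card_erase_of_mem (by grind),
        Finset.card_erase_of_mem hvK]
      have : 1 < K.card := Finset.one_lt_card.2 ⟨v, hvK, w, hwK, hvw⟩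
      omega
    · exact fun _ => ⟨v, by simp⟩
    · rwa [hblue]
  · have hiso' : ∀ w, ¬ X.red.Adj v w := by
      intro w hw
      rcases hred v w hw with h | h | h <;> tauto
    refine ⟨insert u (insert v K), Ce, Le, ⟨?_, ?_, ?_, ?_, ?_, ?_, ?_, ?_, ?_, ?_⟩⟩
    · grind
    · grind
    · grind
    · grind
    · grind
    · intro x hx
      by_cases hxu : x = u
      · exact ⟨v, by grind⟩
      by_cases hxv : x = v
      · exact ⟨u, by grind⟩
      obtain ⟨y, hy⟩ := hpart x (by grind)
      exact ⟨y, by grind⟩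
    · grind
    · rw [Finset.card_insert_of_notMem (by grind), Finset.card_insert_of_notMem hvK]
      omega
    · exact hcen
    · rwa [hblue]

theorem StarInvariant.five_mul_le {ℓ : ℕ} (hℓ : 1 ≤ ℓ) : ∀ (n : ℕ) {X : Position}
    {K Ce Le : Finset ℕ} {R B : ℕ}, StarInvariant X K Ce Le R B →
    BuilderWinsWithin (pathGraph 4) (pathGraph (ℓ + 1)) n X → 7 * ℓ + 2 ≤ 5 * (n + R + B) := by
  have hwon : ∀ {X : Position} {K Ce Le : Finset ℕ} {R B : ℕ}, StarInvariant X K Ce Le R B →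
      Won (pathGraph 4) (pathGraph (ℓ + 1)) X → 7 * ℓ + 2 ≤ 5 * (R + B) := by
    intro X K Ce Le R B h hw
    exact h.of_blue_path hℓ (hw.resolve_left h.no_red_path)
  intro n
  induction n with
  | zero =>
    intro X K Ce Le R B h hw
    have := hwon h hw
    omega
  | succ n ih =>
    intro X K Ce Le R B h hw
    rcases hw with hw | ⟨u, v, huv, hcov, hnew⟩
    · have := hwon h hw
      omega
    · by_cases hc : X.Uncovered u v
      · have := ih h (hcov hc)
        omega
      · obtain ⟨hr, hb⟩ := hnew hc
        have hred : ∀ {K' Ce' Le' : Finset ℕ},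
            StarInvariant (X.paintRed u v) K' Ce' Le' (R + 1) B → 7 * ℓ + 2 ≤ 5 * (n + 1 + R + B) := by
          intro K' Ce' Le' h'
          have := ih h' hr
          omega
        -- Painter's rule: blue unless an end without red edges meets a non-leaf.
        by_cases hblue : (u ∈ K ∪ Ce ∪ Le ∨ v ∈ Le) ∧ (v ∈ K ∪ Ce ∪ Le ∨ u ∈ Le)
        · have := ih (h.paintBlue hblue.1 hblue.2) hb
          omega
        · rw [not_and_or] at hblue
          rcases hblue with hb' | hb'
          · obtain ⟨K', Ce', Le', h'⟩ := h.paintRed huv (not_or.1 hb').1 (not_or.1 hb').2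
            exact hred h'
          · obtain ⟨K', Ce', Le', h'⟩ := h.paintRed huv.symm (not_or.1 hb').1 (not_or.1 hb').2
            rw [Position.paintRed, SimpleGraph.edge_comm] at h'
            exact hred h'

theorem seven_mul_add_two_le {ℓ n : ℕ} (hℓ : 1 ≤ ℓ)
    (h : BuilderWinsWithin (pathGraph 4) (pathGraph (ℓ + 1)) n Position.start) :
    7 * ℓ + 2 ≤ 5 * n := by
  have := StarInvariant.five_mul_le hℓ n (K := ∅) (Ce := ∅) (Le := ∅) (R := 0) (B := 0)
    (X := Position.start) ?_ h
  · omega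
  · constructor <;> simp [Position.start]

/-! ### Upper bound: rounds, forced edges, and joining of blue paths. -/

/-- Builder wins the game of a red `P₄` against a blue path with `ℓ` edges within `n` rounds from
the position with red graph `r` and blue graph `b`. -/
def PathWins (ℓ n : ℕ) (r b : SimpleGraph ℕ) : Prop :=
  BuilderWinsWithin (pathGraph 4) (pathGraph (ℓ + 1)) n ⟨r, b⟩

theorem pathWins_of_won {ℓ n : ℕ} {r b : SimpleGraph ℕ}
    (h : Won (pathGraph 4) (pathGraph (ℓ + 1)) ⟨r, b⟩) : PathWins ℓ n r b := by
  cases n with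
  | zero => exact h
  | succ n => exact Or.inl h

theorem PathWins.succ {ℓ : ℕ} : ∀ {n : ℕ} {r b : SimpleGraph ℕ}, PathWins ℓ n r b →
    PathWins ℓ (n + 1) r b
  | 0, _, _, h => Or.inl h
  | n + 1, r, b, h => by
    rcases h with h | ⟨u, v, huv, h1, h2⟩
    · exact Or.inl h
    · exact Or.inr ⟨u, v, huv, fun hc => PathWins.succ (h1 hc),
        fun hc => ⟨PathWins.succ (h2 hc).1, PathWins.succ (h2 hc).2⟩⟩

theorem PathWins.mono {ℓ n m : ℕ} {r b : SimpleGraph ℕ} (h : PathWins ℓ n r b) (hnm : n ≤ m) :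
    PathWins ℓ m r b := by
  induction hnm with
  | refl => exact h
  | step _ ih => exact ih.succ

theorem sup_edge_eq_left {G : SimpleGraph ℕ} {u v : ℕ} (h : G.Adj u v) : G ⊔ edge u v = G := by
  rw [sup_eq_left, edge_le_iff]
  exact Or.inr h

/-- Builder need not check whether `uv` is new: an already red edge leaves the red graph unchanged
under `⊔`, and an already blue one is covered by `b' = b`. Hence the blue alternative quantifies
over all larger blue graphs containing `uv`. -/
theorem PathWins.step {ℓ n : ℕ} {r b : SimpleGraph ℕ} {u v : ℕ} (huv : u ≠ v)
    (hr : PathWins ℓ n (r ⊔ edge u v) b)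
    (hb : ∀ b', b ≤ b' → b'.Adj u v → PathWins ℓ n r b') : PathWins ℓ (n + 1) r b := by
  refine Or.inr ⟨u, v, huv, ?_, fun _ => ⟨hr, hb _ le_sup_left ?_⟩⟩
  · rintro (h | h)
    · have h' : r ⊔ edge u v = r := sup_edge_eq_left h
      rw [h'] at hr
      exact hr
    · exact hb b le_rfl h
  · simp [edge_adj, huv]

/-- Painter loses if the edge `uv` is red. -/
def RedLoses (r : SimpleGraph ℕ) (u v : ℕ) : Prop :=
  u ≠ v ∧ (pathGraph 4).IsContained (r ⊔ edge u v)

theorem RedLoses.symm {r : SimpleGraph ℕ} {u v : ℕ} (h : RedLoses r u v) : RedLoses r v u := by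
  refine ⟨h.1.symm, ?_⟩
  rw [edge_comm]
  exact h.2

theorem PathWins.forced {ℓ n : ℕ} {r b : SimpleGraph ℕ} {u v : ℕ} (h : RedLoses r u v)
    (hb : ∀ b', b ≤ b' → b'.Adj u v → PathWins ℓ n r b') : PathWins ℓ (n + 1) r b :=
  PathWins.step h.1 (pathWins_of_won (Or.inl h.2)) hb

theorem PathWins.forced_list {ℓ n : ℕ} {r : SimpleGraph ℕ} : ∀ {b : SimpleGraph ℕ}
    (E : List (ℕ × ℕ)), (∀ e ∈ E, RedLoses r e.1 e.2) →
    (∀ b', b ≤ b' → (∀ e ∈ E, b'.Adj e.1 e.2) → PathWins ℓ n r b') →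
    PathWins ℓ (n + E.length) r b
  | b, [], _, h => h b le_rfl (by simp)
  | b, e :: E, hE, h => by
    refine PathWins.forced (hE e (by simp)) fun b₁ hb₁ he => ?_
    refine PathWins.forced_list E (fun e' he' => hE e' (by simp [he'])) fun b₂ hb₂ hE₂ => ?_
    refine h b₂ (hb₁.trans hb₂) ?_
    intro e' he'
    rcases List.mem_cons.1 he' with rfl | he'
    · exact hb₂ he
    · exact hE₂ e' he'

theorem contains_P4 {G : SimpleGraph ℕ} {a b c d : ℕ} (hab : G.Adj a b) (hbc : G.Adj b c)
    (hcd : G.Adj c d) (hac : a ≠ c) (had : a ≠ d) (hbd : b ≠ d) : (pathGraph 4).IsContained G := by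
  refine pathGraph_isContained_of_isChain (p := [a, b, c, d]) ?_ ?_ le_rfl
  · simp [hab, hbc, hcd]
  · have := hab.ne
    have := hbc.ne
    have := hcd.ne
    simp_all

def RedIsolated (r : SimpleGraph ℕ) (v : ℕ) : Prop := ∀ w, ¬ r.Adj v w

def RedTouched (r : SimpleGraph ℕ) (v : ℕ) : Prop := ∃ w, r.Adj v w

/-- `v` is an end of a red path with two edges. -/
def RedLeaf (r : SimpleGraph ℕ) (v : ℕ) : Prop := ∃ p q, r.Adj v p ∧ r.Adj p q ∧ v ≠ q

theorem RedTouched.mono {r s : SimpleGraph ℕ} {v : ℕ} (hrs : r ≤ s) (h : RedTouched r v) :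
    RedTouched s v := h.imp fun _ hw => hrs hw

theorem RedLeaf.mono {r s : SimpleGraph ℕ} {v : ℕ} (hrs : r ≤ s) (h : RedLeaf r v) :
    RedLeaf s v := by
  obtain ⟨p, q, h1, h2, h3⟩ := h
  exact ⟨p, q, hrs h1, hrs h2, h3⟩

theorem RedIsolated.ne {r : SimpleGraph ℕ} {u v : ℕ} (hu : RedIsolated r u)
    (hv : RedTouched r v) : u ≠ v := by
  rintro rfl
  obtain ⟨w, hw⟩ := hv
  exact hu w hw

theorem RedIsolated.sup_edge {r : SimpleGraph ℕ} {u v w : ℕ} (h : RedIsolated r w) (hu : w ≠ u)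
    (hv : w ≠ v) : RedIsolated (r ⊔ edge u v) w := by
  intro x hx
  simp only [sup_adj, edge_adj] at hx
  rcases hx with hx | ⟨⟨rfl, rfl⟩ | ⟨rfl, rfl⟩, -⟩
  · exact h x hx
  · exact hu rfl
  · exact hv rfl

theorem sup_edge_adj_right {G : SimpleGraph ℕ} {u v : ℕ} (h : u ≠ v) : (G ⊔ edge u v).Adj u v := by
  simp [edge_adj, h]

/-- A leaf of a red path with two edges has only blue edges to red-isolated vertices. -/
theorem RedLeaf.redLoses {r : SimpleGraph ℕ} {u v : ℕ} (hv : RedLeaf r v) (hu : RedIsolated r u) :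
    RedLoses r v u := by
  obtain ⟨p, q, hvp, hpq, hvq⟩ := hv
  have huv : u ≠ v := hu.ne ⟨p, hvp⟩
  have hup : u ≠ p := hu.ne ⟨q, hpq⟩
  have huq : u ≠ q := hu.ne ⟨p, hpq.symm⟩
  refine ⟨huv.symm, contains_P4 (sup_edge_adj_right huv.symm).symm ?_ ?_ hup huq hvq⟩
  · exact Or.inl hvp
  · exact Or.inl hpq

/-- If a new red component contains `ab`, then `b` has only blue edges to the vertices of the
older red components. -/
theorem redLoses_of_new {r s : SimpleGraph ℕ} {a b c : ℕ} (hrs : r ≤ s) (ha : RedIsolated r a)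
    (hb : RedIsolated r b) (hab : s.Adj b a) (hc : RedTouched r c) : RedLoses s b c := by
  obtain ⟨d, hcd⟩ := hc
  have hd : RedTouched r d := ⟨c, hcd.symm⟩
  have hc : RedTouched r c := ⟨d, hcd⟩
  refine ⟨hb.ne hc, contains_P4 (a := a) (b := b) (c := c) (d := d) ?_ ?_ ?_ (ha.ne hc) (ha.ne hd)
    (hb.ne hd)⟩
  · exact Or.inl hab.symm
  · exact sup_edge_adj_right (hb.ne hc)
  · exact Or.inl (hrs hcd)

theorem isChain_mono {G H : SimpleGraph ℕ} (h : G ≤ H) {p : List ℕ} (hp : p.IsChain G.Adj) :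
    p.IsChain H.Adj := hp.imp fun _ _ hab => h hab

theorem isChain_reverse {G : SimpleGraph ℕ} {p : List ℕ} :
    p.reverse.IsChain G.Adj ↔ p.IsChain G.Adj := by
  rw [List.isChain_reverse]
  simp only [G.adj_comm]

theorem PathWins.of_path {ℓ n : ℕ} {r b : SimpleGraph ℕ} {p : List ℕ} (hp : p.IsChain b.Adj)
    (hn : p.Nodup) (h : ℓ + 1 ≤ p.length) : PathWins ℓ n r b :=
  pathWins_of_won (Or.inr (pathGraph_isContained_of_isChain hp hn h))

/-- Two blue paths can be joined within three rounds. -/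
theorem PathWins.join {ℓ n : ℕ} {r b : SimpleGraph ℕ} {p q : List ℕ} (hp : p.IsChain b.Adj)
    (hq : q.IsChain b.Adj) (hpq : (p ++ q).Nodup) (hp2 : 2 ≤ p.length) (hq2 : 2 ≤ q.length)
    (h : ∀ (r' b' : SimpleGraph ℕ) (s : List ℕ), b ≤ b' → s.IsChain b'.Adj → s.Perm (p ++ q) → PathWins ℓ n r' b') :
    PathWins ℓ (n + 3) r b := by
  have hends : ∀ t : List ℕ, t.Nodup → 2 ≤ t.length →
      ∃ x y, x ≠ y ∧ x ∈ t ∧ y ∈ t ∧ t.head? = some x ∧ t.getLast? = some y := by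
    intro t ht h2
    match t, h2 with
    | x :: y :: t, _ =>
      refine ⟨x, (y :: t).getLast (by simp), ?_, by simp, ?_, rfl, ?_⟩
      · intro hxy
        exact (List.nodup_cons.1 ht).1 (hxy ▸ List.getLast_mem _)
      · exact List.mem_cons_of_mem _ (List.getLast_mem _)
      · rw [List.getLast?_eq_some_getLast (by simp), List.getLast_cons (by simp)]
  have hnd := List.nodup_append.1 hpq
  obtain ⟨x, x', hx, hxp, hxp', hxh, hxl⟩ := hends p hnd.1 hp2
  obtain ⟨y, y', hy, hyq, hyq', hyh, hyl⟩ := hends q hnd.2.1 hq2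
  have hdisj := hnd.2.2
  refine PathWins.step (u := x) (v := y) (hdisj x hxp y hyq) ?_ ?_
  · refine PathWins.step (u := x) (v := y') (hdisj x hxp y' hyq') ?_ ?_
    -- With `xy` and `xy'` red, a red `x'y'` would complete the red path `x' y' x y`.
    · refine PathWins.forced (u := x') (v := y') ⟨hdisj x' hxp' y' hyq', ?_⟩ ?_
      · refine contains_P4 (a := x') (b := y') (c := x) (d := y) ?_ ?_ ?_ hx.symm
          (hdisj x' hxp' y hyq) hy.symm
        · exact sup_edge_adj_right (hdisj x' hxp' y' hyq')
        · exact Or.inl (sup_edge_adj_right (hdisj x hxp y' hyq')).symm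
        · exact Or.inl (Or.inl (sup_edge_adj_right (hdisj x hxp y hyq)))
      · intro b' hb' hadj
        refine h _ b' (p ++ q.reverse) hb' ?_ ((List.reverse_perm q).append_left p)
        rw [List.isChain_append]
        refine ⟨isChain_mono hb' hp, isChain_reverse.2 (isChain_mono hb' hq), ?_⟩
        simp only [hxl, List.head?_reverse, hyl, Option.mem_def, Option.some.injEq]
        rintro _ rfl _ rfl
        exact hadj
    · intro b' hb' hadj
      refine (h _ b' (p.reverse ++ q.reverse) hb' ?_
        ((List.reverse_perm p).append (List.reverse_perm q))).mono (by omega)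
      rw [List.isChain_append]
      refine ⟨isChain_reverse.2 (isChain_mono hb' hp), isChain_reverse.2 (isChain_mono hb' hq), ?_⟩
      simp only [List.getLast?_reverse, hxh, List.head?_reverse, hyl, Option.mem_def,
        Option.some.injEq]
      rintro _ rfl _ rfl
      exact hadj
  · intro b' hb' hadj
    refine (h _ b' (p.reverse ++ q) hb' ?_ ((List.reverse_perm p).append_right q)).mono (by omega)
    rw [List.isChain_append]
    refine ⟨isChain_reverse.2 (isChain_mono hb' hp), isChain_mono hb' hq, ?_⟩
    simp only [List.getLast?_reverse, hxh, hyh, Option.mem_def, Option.some.injEq]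
    rintro _ rfl _ rfl
    exact hadj

/-- A blue path can be extended by a vertex within three rounds. -/
theorem PathWins.extend {ℓ n : ℕ} {r b : SimpleGraph ℕ} {p : List ℕ} (hp : p.IsChain b.Adj)
    (hn : p.Nodup) (hp0 : p ≠ [])
    (h : ∀ (r' b' : SimpleGraph ℕ) (s : List ℕ), s.IsChain b'.Adj → s.Nodup → s.length = p.length + 1 → PathWins ℓ n r' b') :
    PathWins ℓ (n + 3) r b := by
  obtain ⟨B, hB⟩ : ∃ B, ∀ v ∈ p, v < B := by
    refine ⟨p.sum + 1, fun v hv => ?_⟩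
    have := List.single_le_sum (fun _ _ => Nat.zero_le _) v hv
    omega
  obtain ⟨x, t, rfl⟩ := List.exists_cons_of_ne_nil hp0
  have hx := hB x (by simp)
  have hB' : ∀ i, B + i ∉ x :: t := fun i hi => by
    have := hB _ hi
    omega
  have hcons : ∀ i b' r', b ≤ b' → b'.Adj x (B + i) → PathWins ℓ n r' b' := by
    intro i b' r' hb' hadj
    refine h r' b' ((B + i) :: x :: t) ?_ (List.nodup_cons.2 ⟨hB' i, hn⟩) (by simp)
    rw [List.isChain_cons_cons]
    exact ⟨hadj.symm, isChain_mono hb' hp⟩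
  refine PathWins.step (u := x) (v := B + 0) (by omega) ?_
    (fun b' hb' hadj => (hcons 0 b' r hb' hadj).mono (by omega))
  refine PathWins.step (u := x) (v := B + 1) (by omega) ?_
    (fun b' hb' hadj => (hcons 1 b' _ hb' hadj).mono (by omega))
  -- After two red edges at `x`, the vertex `B` is a leaf, so it can be appended at the other end
  -- `z` of the path.
  have hP4 : ∀ z, z ≠ x → z ≠ B + 0 → z ≠ B + 1 →
      RedLoses (r ⊔ edge x (B + 0) ⊔ edge x (B + 1)) z (B + 0) := by
    intro z h1 h2 h3
    refine ⟨h2, contains_P4 (a := z) (b := B + 0) (c := x) (d := B + 1) ?_ ?_ ?_ h1 h3 (by omega)⟩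
    · exact sup_edge_adj_right h2
    · exact Or.inl (Or.inl (sup_edge_adj_right (by omega)).symm)
    · exact Or.inl (sup_edge_adj_right (by omega))
  -- A one-vertex path has no other end; it is abandoned for the path formed by `B` and a fresh
  -- vertex.
  rcases List.eq_nil_or_concat t with rfl | ⟨t', z, rfl⟩
  · refine PathWins.forced (hP4 (B + 2) (by omega) (by omega) (by omega)) fun b' hb' hadj => ?_
    exact h _ b' [B + 2, B + 0] (by simpa using hadj) (by simp) (by simp)
  · rw [List.concat_eq_append] at *
    have hz := hB z (by simp)
    have hzx : z ≠ x := by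
      rintro rfl
      simp at hn
    refine PathWins.forced (hP4 z hzx (by omega) (by omega)) fun b' hb' hadj => ?_
    refine h _ b' ((x :: (t' ++ [z])) ++ [B + 0]) ?_ ?_ (by simp)
    · rw [List.isChain_append]
      refine ⟨isChain_mono hb' hp, by simp, ?_⟩
      rw [← List.cons_append, List.getLast?_concat]
      simpa using hadj
    · rw [List.nodup_append]
      refine ⟨hn, by simp, ?_⟩
      rintro u hu v hv rfl
      rw [List.mem_singleton] at hv
      exact hB' 0 (hv ▸ hu)

theorem PathWins.of_short_path {ℓ : ℕ} : ∀ {j n : ℕ} {r b : SimpleGraph ℕ} {p : List ℕ},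
    p.IsChain b.Adj → p.Nodup → p ≠ [] → ℓ + 1 ≤ p.length + j → 3 * j ≤ n → PathWins ℓ n r b
  | 0, n, r, b, p, hp, hn, h0, hl, hj => PathWins.of_path hp hn hl
  | j + 1, n, r, b, p, hp, hn, h0, hl, hj => by
    obtain ⟨m, rfl⟩ := Nat.exists_eq_add_of_le' (show 3 ≤ n by omega)
    refine PathWins.extend hp hn h0 fun r' b' s hs hsn hsl => ?_
    refine PathWins.of_short_path (j := j) hs hsn ?_ (by omega) (by omega)
    rintro rfl
    simp at hsl

/-- Disjoint blue paths can be joined and extended at the cost of three rounds for each missing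
edge. -/
theorem PathWins.of_paths {ℓ : ℕ} : ∀ {k n : ℕ} {r b : SimpleGraph ℕ} {P : List (List ℕ)},
    P.length = k + 1 → (∀ p ∈ P, p.IsChain b.Adj ∧ p ≠ []) → P.flatten.Nodup →
    3 * k + 3 * (ℓ + 1 - P.flatten.length) ≤ n → PathWins ℓ n r b
  | 0, n, r, b, P, hl, hP, hn, h => by
    obtain ⟨p, rfl⟩ := List.length_eq_one_iff.1 hl
    simp only [List.flatten_cons, List.flatten_nil, List.append_nil] at hn h
    have := hP p (by simp)
    exact PathWins.of_short_path (j := ℓ + 1 - p.length) this.1 hn this.2 (by omega) (by omega)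
  | k + 1, n, r, b, P, hl, hP, hn, h => by
    obtain ⟨p, q, Q, rfl⟩ : ∃ p q Q, P = p :: q :: Q := by
      match P, hl with
      | p :: q :: Q, _ => exact ⟨p, q, Q, rfl⟩
    have hp := hP p (by simp)
    have hq := hP q (by simp)
    have hp1 := List.length_pos_iff.2 hp.2
    have hq1 := List.length_pos_iff.2 hq.2
    simp only [List.flatten_cons, List.length_append, List.length_cons] at hl hn h
    -- A one-vertex path is discarded: the lost vertex costs one extension, the saved joining the
    -- same three rounds.
    by_cases hp2 : p.length = 1
    · refine PathWins.of_paths (k := k) (P := q :: Q) (by simp; omega)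
        (fun s hs => hP s (List.mem_cons_of_mem _ hs)) ?_ ?_
      · rw [List.flatten_cons]
        exact (List.nodup_append.1 hn).2.1
      · simp only [List.flatten_cons, List.length_append]
        omega
    by_cases hq2 : q.length = 1
    · refine PathWins.of_paths (k := k) (P := p :: Q) (by simp; omega) ?_ ?_ ?_
      · intro s hs
        apply hP s
        simp only [List.mem_cons] at hs ⊢
        tauto
      · rw [List.flatten_cons]
        refine hn.sublist ?_
        exact (List.Sublist.refl p).append (List.sublist_append_right _ _)
      · simp only [List.flatten_cons, List.length_append]
        omega
    obtain ⟨m, rfl⟩ := Nat.exists_eq_add_of_le' (show 3 ≤ n by omega)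
    rw [← List.append_assoc] at hn
    refine PathWins.join hp.1 hq.1 (List.nodup_append.1 hn).1 (by omega) (by omega) ?_
    intro r' b' s hb' hs hperm
    refine PathWins.of_paths (k := k) (P := s :: Q) (by simp; omega) ?_ ?_ ?_
    · intro t ht
      rcases List.mem_cons.1 ht with rfl | ht
      · refine ⟨hs, ?_⟩
        rintro rfl
        have := hperm.length_eq
        simp at this
        omega
      · have := hP t (by simp [ht])
        exact ⟨isChain_mono hb' this.1, this.2⟩
    · rw [List.flatten_cons]
      exact ((hperm.append_right _).nodup_iff).2 hn
    · have := hperm.length_eq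
      simp only [List.flatten_cons, List.length_append] at *
      omega

theorem PathWins.forced_edges {ℓ n : ℕ} {r b : SimpleGraph ℕ} (E : List (ℕ × ℕ))
    (hE : ∀ e ∈ E, RedLoses r e.1 e.2) (hn : E.length ≤ n)
    (h : ∀ b', b ≤ b' → (∀ e ∈ E, b'.Adj e.1 e.2) → PathWins ℓ (n - E.length) r b') :
    PathWins ℓ n r b := by
  have := PathWins.forced_list E hE h
  rwa [Nat.sub_add_cancel hn] at this

/-! ### Upper bound: the stock of blue paths and its potential. -/

/-- A blue path with red-isolated ends. -/
structure IsoPath (r b : SimpleGraph ℕ) (p : List ℕ) : Prop where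
  ne_nil : p ≠ []
  chain : p.IsChain b.Adj
  head : ∀ v ∈ p.head?, RedIsolated r v
  last : ∀ v ∈ p.getLast?, RedIsolated r v

/-- A blue path from a vertex with red edges to a red-isolated vertex. -/
structure HalfPath (r b : SimpleGraph ℕ) (p : List ℕ) : Prop where
  ne_nil : p ≠ []
  chain : p.IsChain b.Adj
  head : ∀ v ∈ p.head?, RedTouched r v
  last : ∀ v ∈ p.getLast?, RedIsolated r v

theorem IsoPath.mono {r b r' b' : SimpleGraph ℕ} {p : List ℕ} (h : IsoPath r b p) (hb : b ≤ b')
    (hr : ∀ v ∈ p, RedIsolated r v → RedIsolated r' v) : IsoPath r' b' p where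
  ne_nil := h.ne_nil
  chain := isChain_mono hb h.chain
  head v hv := hr v (List.mem_of_mem_head? hv) (h.head v hv)
  last v hv := hr v (List.mem_of_getLast? hv) (h.last v hv)

theorem HalfPath.mono {r b r' b' : SimpleGraph ℕ} {p : List ℕ} (h : HalfPath r b p) (hb : b ≤ b')
    (hrr : r ≤ r') (hr : ∀ v ∈ p, RedIsolated r v → RedIsolated r' v) : HalfPath r' b' p where
  ne_nil := h.ne_nil
  chain := isChain_mono hb h.chain
  head v hv := (h.head v hv).mono hrr
  last v hv := hr v (List.mem_of_getLast? hv) (h.last v hv)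

theorem isChain_reverse_append {G : SimpleGraph ℕ} {p q : List ℕ} (hp : p.IsChain G.Adj)
    (hq : q.IsChain G.Adj) (h : ∀ x ∈ p.head?, ∀ y ∈ q.head?, G.Adj x y) :
    (p.reverse ++ q).IsChain G.Adj := by
  rw [List.isChain_append]
  refine ⟨isChain_reverse.2 hp, hq, ?_⟩
  rwa [List.getLast?_reverse]

theorem head?_reverse_append {p q : List ℕ} (hp : p ≠ []) :
    (p.reverse ++ q).head? = p.getLast? := by
  rw [List.head?_append_of_ne_nil _ (by simpa using hp), List.head?_reverse]

theorem getLast?_reverse_append {p q : List ℕ} (hq : q ≠ []) :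
    (p.reverse ++ q).getLast? = q.getLast? := List.getLast?_append_of_ne_nil _ hq

theorem isoPath_reverse_append {r b : SimpleGraph ℕ} {p q : List ℕ} (hp : p ≠ []) (hq : q ≠ [])
    (hpc : p.IsChain b.Adj) (hqc : q.IsChain b.Adj)
    (hpl : ∀ v ∈ p.getLast?, RedIsolated r v) (hql : ∀ v ∈ q.getLast?, RedIsolated r v)
    (h : ∀ x ∈ p.head?, ∀ y ∈ q.head?, b.Adj x y) : IsoPath r b (p.reverse ++ q) where
  ne_nil := by simp [hp]
  chain := isChain_reverse_append hpc hqc h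
  head := by rwa [head?_reverse_append hp]
  last := by rwa [getLast?_reverse_append hq]

/-- Builder's stock of disjoint blue paths below the bound `B`: the paths in `Ms` have two
red-isolated ends, those in `Ds` have one, `C` starts at a vertex with red edges, and `F` consists
of ends of red paths with two edges. -/
structure Stock (r b : SimpleGraph ℕ) (B : ℕ) (Ms Ds : List (List ℕ)) (F C : List ℕ) : Prop where
  nodup : (Ms.flatten ++ Ds.flatten ++ F ++ C).Nodup
  lt : ∀ v ∈ Ms.flatten ++ Ds.flatten ++ F ++ C, v < B
  red_lt : ∀ u v, r.Adj u v → u < B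
  iso : ∀ p ∈ Ms, IsoPath r b p
  half : ∀ p ∈ Ds, HalfPath r b p
  leaf : ∀ v ∈ F, RedLeaf r v
  chain : C.IsChain b.Adj
  head : ∀ v ∈ C.head?, RedTouched r v

def stockSize (Ms Ds : List (List ℕ)) (F C : List ℕ) : ℕ :=
  Ms.flatten.length + Ds.flatten.length + F.length + C.length

/-- The amortized bound for the number of rounds that Builder still needs. -/
def Affordable (ℓ n : ℕ) (Ms Ds : List (List ℕ)) (F C : List ℕ) : Prop :=
  14 * (ℓ + 1) + 16 * Ms.length + 4 * F.length + 13 * Ds.length + 10 * min C.length 1 + 80 ≤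
    10 * n + 14 * stockSize Ms Ds F C ∧
  stockSize Ms Ds F C + Ms.length + min Ds.length 1 ≤ ℓ + 7

/-- These are the positions between turns. With two paths in `Ms`, the first has two distinct ends,
so that one end may receive a red edge while the other stays red-isolated. -/
def NormalStock (Ms Ds : List (List ℕ)) (F : List ℕ) : Prop :=
  Ds.length ≤ 1 ∧ ((∃ M, Ms = [M] ∧ F.length ≤ 1) ∨ ∃ M N, Ms = [M, N] ∧ 2 ≤ M.length ∧ F = [])

def StockWins (ℓ n : ℕ) : Prop :=
  ∀ (r b : SimpleGraph ℕ) (B : ℕ) (Ms Ds : List (List ℕ)) (F C : List ℕ), Stock r b B Ms Ds F C →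
    NormalStock Ms Ds F → Affordable ℓ n Ms Ds F C → PathWins ℓ n r b

theorem Stock.isolated {r b : SimpleGraph ℕ} {B : ℕ} {Ms Ds : List (List ℕ)} {F C : List ℕ}
    (h : Stock r b B Ms Ds F C) {v : ℕ} (hv : B ≤ v) : RedIsolated r v := by
  intro w hw
  have := h.red_lt v w hw
  omega

theorem Stock.mono_blue {r b b' : SimpleGraph ℕ} {B : ℕ} {Ms Ds : List (List ℕ)} {F C : List ℕ}
    (h : Stock r b B Ms Ds F C) (hb : b ≤ b') : Stock r b' B Ms Ds F C where
  __ := h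
  iso p hp := (h.iso p hp).mono hb fun _ _ h => h
  half p hp := (h.half p hp).mono hb le_rfl fun _ _ h => h
  chain := isChain_mono hb h.chain

/-- The endgame: spare leaves are thrown away, everything else is joined and extended at three
rounds each. The size cap in `Affordable` matters here, since vertices beyond `ℓ + 1` lower the
potential without saving any rounds. -/
theorem PathWins.of_stock {ℓ n : ℕ} {r b : SimpleGraph ℕ} {B : ℕ} {Ms Ds : List (List ℕ)}
    {F C : List ℕ} (h : Stock r b B Ms Ds F C) (hMs : 1 ≤ Ms.length)
    (hn : 3 * (Ms.length + Ds.length + min C.length 1 - 1) +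
      3 * (ℓ + 1 - (stockSize Ms Ds F C - F.length)) ≤ n) : PathWins ℓ n r b := by
  have hnd : (Ms.flatten ++ Ds.flatten ++ C).Nodup := by
    refine h.nodup.sublist ?_
    exact (List.sublist_append_left _ _).append (List.Sublist.refl _)
  unfold stockSize at hn
  have hpaths : ∀ p ∈ Ms ++ Ds, p.IsChain b.Adj ∧ p ≠ [] := by
    intro p hp
    rcases List.mem_append.1 hp with hp | hp
    · exact ⟨(h.iso p hp).chain, (h.iso p hp).ne_nil⟩
    · exact ⟨(h.half p hp).chain, (h.half p hp).ne_nil⟩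
  cases C with
  | nil =>
    refine PathWins.of_paths (k := Ms.length + Ds.length - 1) (P := Ms ++ Ds) ?_ hpaths ?_ ?_
    · simp only [List.length_append]
      omega
    · simpa using hnd
    · simp only [List.flatten_append, List.length_append, List.length_nil] at *
      omega
  | cons c C =>
    refine PathWins.of_paths (k := Ms.length + Ds.length) (P := Ms ++ Ds ++ [c :: C]) ?_ ?_ ?_ ?_
    · simp only [List.length_append, List.length_singleton]
    · intro p hp
      rcases List.mem_append.1 hp with hp | hp
      · exact hpaths p hp
      · rw [List.mem_singleton] at hp
        subst hp
        exact ⟨h.chain, by simp⟩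
    · simpa using hnd
    · simp only [List.flatten_append, List.length_append, List.length_cons, List.flatten_cons,
        List.flatten_nil, List.append_nil] at *
      omega

/-- Each turn rearranges the old stock `l` together with fresh vertices `l'` from `[B, B')`;
comparing multiplicities avoids explicit permutations. -/
theorem nodup_and_lt_of_perm {l l' L : List ℕ} {B B' : ℕ} (hl : l.Nodup) (hlB : ∀ v ∈ l, v < B)
    (hl' : l'.Nodup) (hB' : ∀ v ∈ l', B ≤ v ∧ v < B') (hBB : B ≤ B')
    (h : ∀ a, L.count a = l.count a + l'.count a) : L.Nodup ∧ ∀ v ∈ L, v < B' := by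
  have hperm : L.Perm (l ++ l') := by
    rw [List.perm_iff_count]
    intro a
    rw [h, List.count_append]
  constructor
  · rw [hperm.nodup_iff, List.nodup_append]
    refine ⟨hl, hl', ?_⟩
    rintro u hu v hv rfl
    have := hlB u hu
    have := hB' u hv
    omega
  · intro v hv
    rcases List.mem_append.1 (hperm.mem_iff.1 hv) with hv | hv
    · have := hlB v hv
      omega
    · exact (hB' v hv).2

/-- The edges that attach `w` to the path `C`. -/
def pushEdges (w : ℕ) (C : List ℕ) : List (ℕ × ℕ) := C.head?.toList.map fun c => (w, c)

@[simp] theorem length_pushEdges (w : ℕ) (C : List ℕ) :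
    (pushEdges w C).length = min C.length 1 := by
  cases C <;> simp [pushEdges]

theorem mem_pushEdges {w : ℕ} {C : List ℕ} {e : ℕ × ℕ} :
    e ∈ pushEdges w C ↔ ∃ c ∈ C.head?, e = (w, c) := by
  cases C <;> simp [pushEdges]

theorem isChain_push {G : SimpleGraph ℕ} {w : ℕ} {C : List ℕ} (hC : C.IsChain G.Adj)
    (h : ∀ e ∈ pushEdges w C, G.Adj e.1 e.2) : (w :: C).IsChain G.Adj := by
  cases C with
  | nil => simp
  | cons c C =>
    rw [List.isChain_cons_cons]
    exact ⟨h (w, c) (by simp [pushEdges]), hC⟩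

/-- If there is a spare leaf, it is used to join two paths. -/
theorem PathWins.add_isoPath {ℓ n : ℕ} (ih : ∀ k ≤ n, StockWins ℓ k) {r b : SimpleGraph ℕ} {B : ℕ}
    {Q M : List ℕ} {Ds : List (List ℕ)} {F C : List ℕ} (h : Stock r b B [Q, M] Ds F C)
    (hQ : 2 ≤ Q.length) (hDs : Ds.length ≤ 1) (hF : F.length ≤ 1)
    (hn : Affordable ℓ n [Q, M] Ds F C) : PathWins ℓ n r b := by
  match F, hF with
  | [], _ => exact ih n le_rfl r b B _ _ _ _ h ⟨hDs, Or.inr ⟨Q, M, rfl, hQ, rfl⟩⟩ hn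
  | [f], _ =>
    have hQi := h.iso Q (by simp)
    have hMi := h.iso M (by simp)
    have hf := h.leaf f (by simp)
    obtain ⟨q, Q, rfl⟩ := List.exists_cons_of_ne_nil hQi.ne_nil
    obtain ⟨x, M, rfl⟩ := List.exists_cons_of_ne_nil hMi.ne_nil
    have hx := hMi.head x (by simp)
    have hq := hQi.head q (by simp)
    -- The leaf is inserted between the two paths: two rounds cost 20, exactly the 16 of one path
    -- plus the 4 of the leaf.
    refine PathWins.forced_edges [(x, f), (f, q)] ?_ ?_ ?_
    · simpa using ⟨(hf.redLoses hx).symm, hf.redLoses hq⟩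
    · simp [Affordable, stockSize] at hn ⊢
      omega
    · intro b' hb' hadj
      simp only [List.mem_cons, List.not_mem_nil, or_false, forall_eq_or_imp, forall_eq] at hadj
      have h' := h.mono_blue hb'
      have hQ' := h'.iso (q :: Q) (by simp)
      have hM' := h'.iso (x :: M) (by simp)
      obtain ⟨hnd, hlt⟩ := nodup_and_lt_of_perm (l' := []) (B' := B)
        (L := [(x :: M).reverse ++ f :: q :: Q].flatten ++ Ds.flatten ++ [] ++ C) h.nodup h.lt
        (by simp) (by simp) le_rfl (by
          intro a
          simp [List.count_cons]
          ring)
      refine ih _ (by simp) r b' B [(x :: M).reverse ++ f :: q :: Q] Ds [] C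
        ⟨hnd, hlt, h.red_lt, ?_, h'.half, by simp, h'.chain, h'.head⟩ ⟨hDs, Or.inl ⟨_, rfl, by simp⟩⟩ ?_
      · simp only [List.mem_singleton, forall_eq]
        refine isoPath_reverse_append (by simp) (by simp) hM'.chain ?_ hM'.last ?_ ?_
        · rw [List.isChain_cons_cons]
          exact ⟨hadj.2, hQ'.chain⟩
        · simpa using hQ'.last
        · simpa using hadj.1
      · simp [Affordable, stockSize] at hn ⊢
        omega

/-- Two paths with one red-isolated end each are joined. -/
theorem PathWins.add_halfPath {ℓ n : ℕ} (ih : ∀ k ≤ n, StockWins ℓ k) {r b : SimpleGraph ℕ} {B : ℕ}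
    {Q M : List ℕ} {Ds : List (List ℕ)} {F C : List ℕ} (h : Stock r b B [M] (Q :: Ds) F C)
    (hQ : ∀ u ∈ Q.head?, ∀ D ∈ Ds, ∀ v ∈ D.head?, RedLoses r u v)
    (hDs : Ds.length ≤ 1) (hF : F.length ≤ 1)
    (hn : Affordable ℓ n [M] (Q :: Ds) F C) : PathWins ℓ n r b := by
  match Ds, hDs with
  | [], _ => exact ih n le_rfl r b B _ _ _ _ h ⟨by simp, Or.inl ⟨M, rfl, hF⟩⟩ hn
  | [D], _ =>
    have hQi := h.half Q (by simp)
    have hDi := h.half D (by simp)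
    obtain ⟨q, Q, rfl⟩ := List.exists_cons_of_ne_nil hQi.ne_nil
    obtain ⟨d, D, rfl⟩ := List.exists_cons_of_ne_nil hDi.ne_nil
    -- One round costs 10, and two half-open paths become one open path: `2 · 13 - 16 = 10`.
    refine PathWins.forced_edges [(q, d)] ?_ ?_ ?_
    · simpa using hQ
    · simp [Affordable, stockSize] at hn ⊢
      omega
    · intro b' hb' hadj
      simp only [List.mem_singleton, forall_eq] at hadj
      have h' := h.mono_blue hb'
      have hQ' := h'.half (q :: Q) (by simp)
      have hD' := h'.half (d :: D) (by simp)
      obtain ⟨hnd, hlt⟩ := nodup_and_lt_of_perm (l' := []) (B' := B)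
        (L := [(q :: Q).reverse ++ d :: D, M].flatten ++ [].flatten ++ F ++ C) h.nodup h.lt
        (by simp) (by simp) le_rfl (by
          intro a
          simp [List.count_cons]
          ring)
      refine PathWins.add_isoPath (n := n - [(q, d)].length) (fun k hk => ih k (hk.trans (by simp)))
        (r := r) (b := b') (B := B) (Q := (q :: Q).reverse ++ d :: D) (M := M) (Ds := []) (F := F)
        (C := C) ⟨hnd, hlt, h.red_lt, ?_, by simp, h'.leaf, h'.chain, h'.head⟩ ?_ (by simp) hF ?_
      · simp only [List.mem_cons, List.not_mem_nil, or_false, forall_eq_or_imp, forall_eq]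
        refine ⟨?_, h'.iso M (by simp)⟩
        refine isoPath_reverse_append (by simp) (by simp) hQ'.chain hD'.chain hQ'.last hD'.last ?_
        simpa using hadj
      · simp
        omega
      · simp [Affordable, stockSize] at hn ⊢
        omega

theorem redIsolated_sup_edge_of_lt {r : SimpleGraph ℕ} {u v w B : ℕ} (hu : B ≤ u) (hv : B ≤ v)
    (hw : w < B) (h : RedIsolated r w) : RedIsolated (r ⊔ edge u v) w :=
  h.sup_edge (by omega) (by omega)

theorem sup_edge_lt {r : SimpleGraph ℕ} {u v B B' : ℕ} (hr : ∀ x y, r.Adj x y → x < B)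
    (hB : B ≤ B') (hu : u < B') (hv : v < B') : ∀ x y, (r ⊔ edge u v).Adj x y → x < B' := by
  intro x y hxy
  simp only [sup_adj, edge_adj] at hxy
  rcases hxy with hxy | ⟨⟨rfl, rfl⟩ | ⟨rfl, rfl⟩, -⟩
  · exact (hr x y hxy).trans_le hB
  · exact hu
  · exact hv

theorem Stock.redLoses_push {r s b : SimpleGraph ℕ} {B : ℕ} {Ms Ds : List (List ℕ)}
    {F C : List ℕ} (h : Stock r b B Ms Ds F C) (hrs : r ≤ s) {a w : ℕ} (ha : RedIsolated r a)
    (hw : RedIsolated r w) (haw : s.Adj w a) : ∀ e ∈ pushEdges w C, RedLoses s e.1 e.2 := by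
  intro e he
  obtain ⟨c, hc, rfl⟩ := mem_pushEdges.1 he
  exact redLoses_of_new hrs ha hw haw (h.head c hc)

theorem Stock.redLoses_half {r s b : SimpleGraph ℕ} {B : ℕ} {Ms Ds : List (List ℕ)}
    {F C : List ℕ} (h : Stock r b B Ms Ds F C) (hrs : r ≤ s) {a w : ℕ} (ha : RedIsolated r a)
    (hw : RedIsolated r w) (haw : s.Adj w a) : ∀ D ∈ Ds, ∀ v ∈ D.head?, RedLoses s w v := by
  intro D hD v hv
  exact redLoses_of_new hrs ha hw haw ((h.half D hD).head v hv)

/-! ### Upper bound: Builder's turns. -/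

/-- Builder tries to draw a red star with two leaves at the new vertex `B`. In every case, attaching
a vertex to an empty `C` needs no round, and the saved 10 covers the term that a nonempty `C` adds
to the potential. -/
theorem StockWins.of_single {ℓ n : ℕ} (ih : ∀ k < n, StockWins ℓ k) {r b : SimpleGraph ℕ} {B : ℕ}
    {M : List ℕ} {Ds : List (List ℕ)} {F C : List ℕ} (h : Stock r b B [M] Ds F C)
    (hDs : Ds.length ≤ 1) (hF : F.length ≤ 1)
    (hn : Affordable ℓ n [M] Ds F C) (hsize : stockSize [M] Ds F C < ℓ) : PathWins ℓ n r b := by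
  obtain ⟨k, rfl⟩ : ∃ k, n = k + 10 := by
    simp [Affordable] at hn
    exact ⟨n - 10, by omega⟩
  simp [Affordable, stockSize] at hn hsize
  have hiso : ∀ {i}, B ≤ i → RedIsolated r i := fun hi => h.isolated hi
  have hMi := h.iso M (by simp)
  have hMne := hMi.ne_nil
  have hMlt : ∀ v ∈ M, v < B := fun v hv => h.lt v (by simp [hv])
  have hDlt : ∀ D ∈ Ds, ∀ v ∈ D, v < B := fun D hD v hv => h.lt v (by
    simp only [List.mem_append, List.mem_flatten]
    exact Or.inl (Or.inl (Or.inr ⟨D, hD, hv⟩)))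
  refine PathWins.step (u := B) (v := B + 1) (by omega) ?_ fun b₁ hb₁ hadj₁ => ?_
  swap
  -- A blue edge brings two vertices in one round: `28 - 10` exceeds the 16 of the new path.
  · have h₁ := h.mono_blue hb₁
    obtain ⟨hnd, hlt⟩ := nodup_and_lt_of_perm (l' := [B, B + 1]) (B' := B + 2)
      (L := [[B, B + 1], M].flatten ++ Ds.flatten ++ F ++ C) h.nodup h.lt
      (by simp) (by simp) (by omega) (by
        intro a
        simp [List.count_cons]
        ring)
    refine PathWins.add_isoPath (fun j hj => ih j (by omega)) (B := B + 2) (Q := [B, B + 1])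
      (M := M) (Ds := Ds) (F := F) (C := C) ⟨hnd, hlt, fun u v huv => (h.red_lt u v huv).trans
      (by omega), ?_, h₁.half, h.leaf, h₁.chain, h.head⟩ (by simp) hDs hF ?_
    · simp only [List.mem_cons, List.not_mem_nil, or_false, forall_eq_or_imp, forall_eq]
      exact ⟨⟨by simp, by simpa using hadj₁, by simpa using hiso le_rfl,
        by simpa using hiso (by omega)⟩, h₁.iso M (by simp)⟩
    · simp [Affordable, stockSize]
      omega
  set r₁ := r ⊔ edge B (B + 1) with hr₁
  have hrr₁ : r ≤ r₁ := le_sup_left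
  have hab₁ : r₁.Adj B (B + 1) := sup_edge_adj_right (by omega)
  have hlt₁ := sup_edge_lt (B' := B + 2) h.red_lt (by omega) (show B < B + 2 by omega)
    (show B + 1 < B + 2 by omega)
  have hold₁ : ∀ v, v < B → RedIsolated r v → RedIsolated r₁ v := fun v hv =>
    redIsolated_sup_edge_of_lt le_rfl (by omega) hv
  have hnew₁ : ∀ v, B + 2 ≤ v → RedIsolated r₁ v := fun v hv =>
    (hiso (by omega)).sup_edge (by omega) (by omega)
  refine PathWins.step (u := B) (v := B + 2) (by omega) ?_ fun b₂ hb₂ hadj₂ => ?_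
  -- The ideal case: both leaves, separated by fresh vertices, lengthen `M`, and the centre goes to
  -- `C`. Seven rounds for five vertices, `70 = 5 · 14`.
  · set r₂ := r₁ ⊔ edge B (B + 2) with hr₂
    have hrr₂ : r₁ ≤ r₂ := le_sup_left
    have hrr := hrr₁.trans hrr₂
    have ha1 : r₂.Adj B (B + 1) := hrr₂ hab₁
    have ha2 : r₂.Adj B (B + 2) := sup_edge_adj_right (by omega)
    have hlt₂ := sup_edge_lt (B' := B + 5) hlt₁ (by omega) (show B < B + 5 by omega)
      (show B + 2 < B + 5 by omega)
    have hold₂ : ∀ v, v < B → RedIsolated r v → RedIsolated r₂ v := fun v hv hvi =>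
      redIsolated_sup_edge_of_lt le_rfl (by omega) hv (hold₁ v hv hvi)
    have hnew₂ : ∀ v, B + 3 ≤ v → RedIsolated r₂ v := fun v hv =>
      (hnew₁ v (by omega)).sup_edge (by omega) (by omega)
    have hl1 : RedLeaf r₂ (B + 1) := ⟨B, B + 2, ha1.symm, ha2, by omega⟩
    have hl2 : RedLeaf r₂ (B + 2) := ⟨B, B + 1, ha2.symm, ha1, by omega⟩
    obtain ⟨x, M, rfl⟩ := List.exists_cons_of_ne_nil hMne
    have hx : RedIsolated r₂ x := hold₂ x (hMlt x (by simp)) (hMi.head x (by simp))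
    refine PathWins.forced_edges ([(B + 4, B + 1), (B + 1, B + 3), (B + 3, B + 2), (B + 2, x)] ++
      pushEdges B C) ?_ ?_ fun b₂ hb₂ hadj₂ => ?_
    · intro e he
      rcases List.mem_append.1 he with he | he
      · simp only [List.mem_cons, List.not_mem_nil, or_false] at he
        rcases he with rfl | rfl | rfl | rfl
        · exact (hl1.redLoses (hnew₂ _ (by omega))).symm
        · exact hl1.redLoses (hnew₂ _ (by omega))
        · exact (hl2.redLoses (hnew₂ _ (by omega))).symm
        · exact hl2.redLoses hx
      · exact h.redLoses_push hrr (hiso (i := B + 1) (by omega)) (hiso le_rfl) ha1 e he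
    · simp
    · have hpush := isChain_push (isChain_mono hb₂ h.chain)
        fun e he => hadj₂ e (List.mem_append_right _ he)
      obtain ⟨hnd, hlt⟩ := nodup_and_lt_of_perm (l' := [B, B + 1, B + 2, B + 3, B + 4])
        (B' := B + 5) (L := [(B + 4) :: (B + 1) :: (B + 3) :: (B + 2) :: x :: M].flatten ++
          Ds.flatten ++ F ++ (B :: C)) h.nodup h.lt
        (by simp) (by simp) (by omega) (by
          intro a
          simp [List.count_cons]
          ring)
      refine ih _ (by omega) r₂ b₂ (B + 5) [(B + 4) :: (B + 1) :: (B + 3) :: (B + 2) :: x :: M] Ds F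
        (B :: C) ⟨hnd, hlt, hlt₂, ?_, ?_, ?_, hpush, ?_⟩ ⟨hDs, Or.inl ⟨_, rfl, hF⟩⟩ ?_
      · simp only [List.mem_singleton, forall_eq]
        have hM' := hMi.mono hb₂ fun v hv => hold₂ v (hMlt v hv)
        refine ⟨by simp, ?_, ?_, ?_⟩
        · simp only [List.isChain_cons_cons]
          exact ⟨hadj₂ (_, _) (by simp), hadj₂ (_, _) (by simp), hadj₂ (_, _) (by simp),
            hadj₂ (_, _) (by simp), hM'.chain⟩
        · simpa using hnew₂ (B + 4) (by omega)
        · simpa using hM'.last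
      · exact fun D hD => (h.half D hD).mono hb₂ hrr fun v hv => hold₂ v (hDlt D hD v hv)
      · exact fun v hv => (h.leaf v hv).mono hrr
      · simpa using ⟨B + 1, ha1⟩
      · simp [Affordable, stockSize] at hn hsize ⊢
        omega
  refine PathWins.step (u := B) (v := B + 3) (by omega) ?_ fun b₃ hb₃ hadj₃ => ?_
  -- The blue edge from `B` to `B + 2` makes `M` a path with the touched end `B`, and leaf `B + 1`
  -- yields a new path with isolated ends. Seven rounds for six vertices: `84 - 70` covers the 13 of
  -- the half-open path.
  · set r₂ := r₁ ⊔ edge B (B + 3) with hr₂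
    have hrr₂ : r₁ ≤ r₂ := le_sup_left
    have hrr := hrr₁.trans hrr₂
    have ha1 : r₂.Adj B (B + 1) := hrr₂ hab₁
    have ha3 : r₂.Adj B (B + 3) := sup_edge_adj_right (by omega)
    have hlt₂ := sup_edge_lt (B' := B + 6) hlt₁ (by omega) (show B < B + 6 by omega)
      (show B + 3 < B + 6 by omega)
    have hold₂ : ∀ v, v < B → RedIsolated r v → RedIsolated r₂ v := fun v hv hvi =>
      redIsolated_sup_edge_of_lt le_rfl (by omega) hv (hold₁ v hv hvi)
    have hnew₂ : ∀ v, B + 4 ≤ v → RedIsolated r₂ v := fun v hv =>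
      (hnew₁ v (by omega)).sup_edge (by omega) (by omega)
    have hi2 : RedIsolated r₂ (B + 2) := (hnew₁ _ le_rfl).sup_edge (by omega) (by omega)
    have hl1 : RedLeaf r₂ (B + 1) := ⟨B, B + 3, ha1.symm, ha3, by omega⟩
    have hl3 : RedLeaf r₂ (B + 3) := ⟨B, B + 1, ha3.symm, ha1, by omega⟩
    obtain ⟨x, M, rfl⟩ := List.exists_cons_of_ne_nil hMne
    have hx : RedIsolated r₂ x := hold₂ x (hMlt x (by simp)) (hMi.head x (by simp))
    refine PathWins.forced_edges [(B + 2, B + 3), (B + 3, x), (B + 4, B + 1), (B + 1, B + 5)]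
      ?_ ?_ fun b₃ hb₃ hadj₃ => ?_
    · simp only [List.mem_cons, List.not_mem_nil, or_false, forall_eq_or_imp, forall_eq]
      exact ⟨(hl3.redLoses hi2).symm, hl3.redLoses hx, (hl1.redLoses (hnew₂ _ le_rfl)).symm,
        hl1.redLoses (hnew₂ _ (by omega))⟩
    · simp
    · have hb := hb₂.trans hb₃
      simp only [List.mem_cons, List.not_mem_nil, or_false, forall_eq_or_imp, forall_eq] at hadj₃
      obtain ⟨e1, e2, e3, e4⟩ := hadj₃
      obtain ⟨hnd, hlt⟩ := nodup_and_lt_of_perm (l' := [B, B + 1, B + 2, B + 3, B + 4, B + 5])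
        (B' := B + 6) (L := [[B + 4, B + 1, B + 5]].flatten ++
          ((B :: (B + 2) :: (B + 3) :: x :: M) :: Ds).flatten ++ F ++ C) h.nodup h.lt
        (by simp) (by simp) (by omega) (by
          intro a
          simp [List.count_cons]
          ring)
      refine PathWins.add_halfPath (B := B + 6) (M := [B + 4, B + 1, B + 5])
        (Q := B :: (B + 2) :: (B + 3) :: x :: M) (Ds := Ds) (F := F) (C := C)
        (fun j hj => ih j (hj.trans_lt (by simp)))
        ⟨hnd, hlt, hlt₂, ?_, ?_, ?_, isChain_mono hb h.chain, ?_⟩ ?_ hDs hF ?_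
      · simp only [List.mem_singleton, forall_eq]
        exact ⟨by simp, by simp [e3, e4], by simpa using hnew₂ _ le_rfl,
          by simpa using hnew₂ (B + 5) (by omega)⟩
      · simp only [List.mem_cons, forall_eq_or_imp]
        have hM' := hMi.mono hb fun v hv => hold₂ v (hMlt v hv)
        refine ⟨⟨by simp, ?_, ?_, ?_⟩, ?_⟩
        · simp only [List.isChain_cons_cons]
          exact ⟨hb₃ hadj₂, e1, e2, hM'.chain⟩
        · simpa using ⟨B + 1, ha1⟩
        · simpa using hM'.last
        · exact fun D hD => (h.half D hD).mono hb hrr fun v hv => hold₂ v (hDlt D hD v hv)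
      · exact fun v hv => (h.leaf v hv).mono hrr
      · exact fun v hv => (h.head v hv).mono hrr
      · simpa using h.redLoses_half hrr (hiso (i := B + 1) (by omega)) (hiso le_rfl) ha1
      · simp [Affordable, stockSize] at hn hsize ⊢
        omega
  -- Two blue edges make `B` the middle of a new open path, while `B + 1` goes to `C`. Four rounds
  -- for four vertices: `56 - 40 = 16`.
  · refine PathWins.forced_edges (pushEdges (B + 1) C)
      (h.redLoses_push hrr₁ (hiso le_rfl) (hiso (by omega)) hab₁.symm) (by simp)
      fun b₄ hb₄ hadj₄ => ?_
    have hb := hb₂.trans (hb₃.trans hb₄)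
    have hpush := isChain_push (isChain_mono hb h.chain) hadj₄
    obtain ⟨hnd, hlt⟩ := nodup_and_lt_of_perm (l' := [B, B + 1, B + 2, B + 3])
      (B' := B + 4) (L := [[B + 2, B, B + 3], M].flatten ++ Ds.flatten ++ F ++ ((B + 1) :: C))
      h.nodup h.lt (by simp) (by simp) (by omega) (by
        intro a
        simp [List.count_cons]
        ring)
    refine PathWins.add_isoPath (B := B + 4) (M := M) (Q := [B + 2, B, B + 3]) (Ds := Ds) (F := F)
      (C := (B + 1) :: C) (fun j hj => ih j (hj.trans_lt (by omega)))
      ⟨hnd, hlt, fun u v huv => (hlt₁ u v huv).trans (by omega), ?_, ?_, ?_, hpush, ?_⟩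
      (by simp) hDs hF ?_
    · simp only [List.mem_cons, List.not_mem_nil, or_false, forall_eq_or_imp, forall_eq]
      refine ⟨⟨by simp, ?_, by simpa using hnew₁ _ le_rfl, by simpa using hnew₁ _ (by omega)⟩,
        hMi.mono hb fun v hv => hold₁ v (hMlt v hv)⟩
      simp only [List.isChain_cons_cons, List.isChain_singleton, and_true]
      exact ⟨hb₄ (hb₃ hadj₂.symm), hb₄ hadj₃⟩
    · exact fun D hD => (h.half D hD).mono hb hrr₁ fun v hv => hold₁ v (hDlt D hD v hv)
    · exact fun v hv => (h.leaf v hv).mono hrr₁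
    · simpa using ⟨B, hab₁.symm⟩
    · simp [Affordable, stockSize] at hn hsize ⊢
      omega

/-- Builder extends the blue path `Y` until an edge becomes red. -/
theorem StockWins.of_growing {ℓ : ℕ} : ∀ {n : ℕ}, (∀ k < n, StockWins ℓ k) →
    ∀ {r b : SimpleGraph ℕ} {B : ℕ} {Y M N : List ℕ} {Ds : List (List ℕ)} {C : List ℕ},
    Stock r b B [Y, M, N] Ds [] C → 2 ≤ Y.length → 2 ≤ M.length → Ds.length ≤ 1 →
    14 * (ℓ + 1) + 13 * Ds.length + 10 * min C.length 1 + 130 ≤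
      10 * n + 14 * stockSize [Y, M, N] Ds [] C →
    stockSize [Y, M, N] Ds [] C ≤ ℓ + 1 → PathWins ℓ n r b := by
  -- The constant is `130 = 80 + 3 · 16 + 2`: the first blue edge of `Y` left a surplus of 2, which
  -- the case of two red edges at `u` needs.
  intro n
  induction n with
  | zero =>
    intro _ r b B Y M N Ds C _ _ _ _ hn hsize
    omega
  | succ n ihn =>
  intro ih r b B Y M N Ds C h hY hM hDs hn hsize
  by_cases hfin : ℓ ≤ stockSize [Y, M, N] Ds [] C
  · refine PathWins.of_stock h (by simp) ?_
    simp only [List.length_cons, List.length_nil]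
    omega
  obtain ⟨k, rfl⟩ : ∃ k, n = k + 9 := ⟨n - 9, by omega⟩
  simp [stockSize] at hn hsize hfin
  have hYi := h.iso Y (by simp)
  have hMi := h.iso M (by simp)
  have hNi := h.iso N (by simp)
  obtain ⟨u, Y, rfl⟩ := List.exists_cons_of_ne_nil hYi.ne_nil
  obtain ⟨x, M, rfl⟩ := List.exists_cons_of_ne_nil hMi.ne_nil
  obtain ⟨x', N, rfl⟩ := List.exists_cons_of_ne_nil hNi.ne_nil
  obtain ⟨u', Y, rfl⟩ : ∃ u' Y', Y = u' :: Y' := by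
    cases Y with
    | nil => simp at hY
    | cons u' Y => exact ⟨u', Y, rfl⟩
  obtain ⟨x₂, M, rfl⟩ : ∃ x₂ M', M = x₂ :: M' := by
    cases M with
    | nil => simp at hM
    | cons x₂ M => exact ⟨x₂, M, rfl⟩
  have hnd : ((u :: u' :: Y) ++ ((x :: x₂ :: M) ++ ((x' :: N) ++ Ds.flatten))).Nodup := by
    simpa using (List.nodup_append.1 (List.nodup_append.1 h.nodup).1).1
  have hlt : ∀ v ∈ (u :: u' :: Y) ++ ((x :: x₂ :: M) ++ ((x' :: N) ++ Ds.flatten)), v < B :=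
    fun v hv => h.lt v (List.mem_append_left _ (List.mem_append_left _ (by simpa using hv)))
  have hltY : ∀ v ∈ u :: u' :: Y, v < B := fun v hv => hlt v (List.mem_append_left _ hv)
  have hltM : ∀ v ∈ x :: x₂ :: M, v < B := fun v hv =>
    hlt v (List.mem_append_right _ (List.mem_append_left _ hv))
  have hltN : ∀ v ∈ x' :: N, v < B := fun v hv =>
    hlt v (List.mem_append_right _ (List.mem_append_right _ (List.mem_append_left _ hv)))
  have hDmem : ∀ D ∈ Ds, ∀ v ∈ D, v ∈ Ds.flatten := fun D hD v hv =>
    List.mem_flatten.2 ⟨D, hD, hv⟩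
  have hltD : ∀ D ∈ Ds, ∀ v ∈ D, v < B := fun D hD v hv => hlt v (List.mem_append_right _
    (List.mem_append_right _ (List.mem_append_right _ (hDmem D hD v hv))))
  obtain ⟨hndY, hndR, hdisj⟩ := List.nodup_append.1 hnd
  have hxR := (List.nodup_cons.1 hndR).1
  have huY : ∀ v ∈ u' :: Y, v ≠ u := fun v hv => ne_of_mem_of_not_mem hv (List.nodup_cons.1 hndY).1
  have huM : ∀ v ∈ x :: x₂ :: M, v ≠ u := fun v hv =>
    (hdisj u (by simp) v (List.mem_append_left _ hv)).symm
  have huN : ∀ v ∈ x' :: N, v ≠ u := fun v hv =>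
    (hdisj u (by simp) v (List.mem_append_right _ (List.mem_append_left _ hv))).symm
  have huD : ∀ D ∈ Ds, ∀ v ∈ D, v ≠ u := fun D hD v hv => (hdisj u (by simp) v
    (List.mem_append_right _ (List.mem_append_right _ (hDmem D hD v hv)))).symm
  have hxY : ∀ v ∈ u :: u' :: Y, v ≠ x := fun v hv => hdisj v hv x (by simp)
  have hxM : ∀ v ∈ x₂ :: M, v ≠ x := fun v hv =>
    ne_of_mem_of_not_mem (List.mem_append_left _ hv) hxR
  have hxN : ∀ v ∈ x' :: N, v ≠ x := fun v hv =>
    ne_of_mem_of_not_mem (List.mem_append_right _ (List.mem_append_left _ hv)) hxR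
  have hxD : ∀ D ∈ Ds, ∀ v ∈ D, v ≠ x := fun D hD v hv =>
    ne_of_mem_of_not_mem (List.mem_append_right _ (List.mem_append_right _ (hDmem D hD v hv))) hxR
  have hiso : ∀ {i}, B ≤ i → RedIsolated r i := fun hi => h.isolated hi
  have hu : RedIsolated r u := hYi.head u (by simp)
  have hx : RedIsolated r x := hMi.head x (by simp)
  have hx' : RedIsolated r x' := hNi.head x' (by simp)
  have huB : u < B := hltY u (by simp)
  have hxB : x < B := hltM x (by simp)
  have hxu : x ≠ u := huM x (by simp)
  refine PathWins.step (u := u) (v := B) (by omega) ?_ fun b₁ hb₁ hadj₁ => ?_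
  swap
  -- One more vertex of `Y` for one round is a gain of 4, so growing can only help Builder.
  · have h₁ := h.mono_blue hb₁
    obtain ⟨hnd, hlt⟩ := nodup_and_lt_of_perm (l' := [B]) (B' := B + 1)
      (L := [B :: u :: u' :: Y, x :: x₂ :: M, x' :: N].flatten ++ Ds.flatten ++ [] ++ C)
      h.nodup h.lt (by simp) (by simp) (by omega) (by
        intro a
        simp [List.count_cons])
    have hY₁ := h₁.iso (u :: u' :: Y) (by simp)
    refine ihn (fun j hj => ih j (by omega)) (B := B + 1) (Y := B :: u :: u' :: Y)
      (M := x :: x₂ :: M) (N := x' :: N) (Ds := Ds) (C := C) ⟨hnd, hlt,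
        fun u v huv => (h.red_lt u v huv).trans (by omega), ?_, h₁.half, by simp, h₁.chain,
        h.head⟩ (by simp) (by simp) hDs ?_ ?_
    · simp only [List.mem_cons, List.not_mem_nil, or_false, forall_eq_or_imp, forall_eq]
      refine ⟨⟨by simp, ?_, by simpa using hiso le_rfl, by simpa using hY₁.last⟩,
        h₁.iso _ (by simp), h₁.iso _ (by simp)⟩
      rw [List.isChain_cons_cons]
      exact ⟨hadj₁.symm, hY₁.chain⟩
    · simp [stockSize] at hn ⊢
      omega
    · simp [stockSize] at hfin ⊢
      omega
  set r₁ := r ⊔ edge u B with hr₁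
  have hrr₁ : r ≤ r₁ := le_sup_left
  have huw : r₁.Adj u B := sup_edge_adj_right (by omega)
  have hlt₁ := sup_edge_lt (B' := B + 1) h.red_lt (by omega) (show u < B + 1 by omega)
    (show B < B + 1 by omega)
  have hold₁ : ∀ v, v < B → v ≠ u → RedIsolated r v → RedIsolated r₁ v := fun v hv hvu hvi =>
    hvi.sup_edge hvu (by omega)
  refine PathWins.step (u := x) (v := u) hxu ?_ fun b₂ hb₂ hadj₂ => ?_
  -- Leaf `x` is forced to join `M` to `N`, `Y` becomes half-open at the star centre `u`, and `B` is
  -- a spare leaf. The income `14 + 32 - 13 - 4 = 29` and the surplus 2 pay for three rounds.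
  · set r₂ := r₁ ⊔ edge x u with hr₂
    have hrr₂ : r₁ ≤ r₂ := le_sup_left
    have hrr := hrr₁.trans hrr₂
    have huw₂ : r₂.Adj u B := hrr₂ huw
    have hxu₂ : r₂.Adj x u := sup_edge_adj_right hxu
    have hlt₂ := sup_edge_lt (B' := B + 1) hlt₁ (by omega) (show x < B + 1 by omega)
      (show u < B + 1 by omega)
    have hold₂ : ∀ v, v < B → v ≠ u → v ≠ x → RedIsolated r v → RedIsolated r₂ v :=
      fun v hv hvu hvx hvi => (hold₁ v hv hvu hvi).sup_edge hvx hvu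
    have hlx : RedLeaf r₂ x := ⟨u, B, hxu₂, huw₂, by omega⟩
    have hlw : RedLeaf r₂ B := ⟨u, x, huw₂.symm, hxu₂.symm, by omega⟩
    have hx'₂ := hold₂ x' (hltN x' (by simp)) (huN x' (by simp)) (hxN x' (by simp)) hx'
    refine PathWins.forced_edges [(x, x')] (by simpa using hlx.redLoses hx'₂) (by simp)
      fun b₂ hb₂ hadj₂ => ?_
    simp only [List.mem_singleton, forall_eq] at hadj₂
    have h₂ := h.mono_blue hb₂
    obtain ⟨hnd, hlt⟩ := nodup_and_lt_of_perm (l' := [B]) (B' := B + 1)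
      (L := [(x :: x₂ :: M).reverse ++ x' :: N].flatten ++ ((u :: u' :: Y) :: Ds).flatten ++ [B] ++ C)
      h.nodup h.lt (by simp) (by simp) (by omega) (by
        intro a
        simp [List.count_cons]
        ring)
    have hY₂ := h₂.iso (u :: u' :: Y) (by simp)
    have hM₂ := h₂.iso (x :: x₂ :: M) (by simp)
    have hN₂ := h₂.iso (x' :: N) (by simp)
    refine PathWins.add_halfPath (B := B + 1) (M := (x :: x₂ :: M).reverse ++ x' :: N)
      (Q := u :: u' :: Y) (Ds := Ds) (F := [B]) (C := C) (fun j hj => ih j (hj.trans_lt (by simp)))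
      ⟨hnd, hlt, hlt₂, ?_, ?_, ?_, h₂.chain, ?_⟩ ?_ hDs (by simp) ?_
    · simp only [List.mem_singleton, forall_eq]
      refine isoPath_reverse_append (by simp) (by simp) hM₂.chain hN₂.chain ?_ ?_ (by simpa using hadj₂)
      · intro v hv
        have hv' : v ∈ x₂ :: M := by
          rw [List.getLast?_cons_cons] at hv
          exact List.mem_of_getLast? hv
        exact hold₂ v (hltM v (List.mem_cons_of_mem _ hv')) (huM v (List.mem_cons_of_mem _ hv'))
          (hxM v hv') (hM₂.last v hv)
      · intro v hv
        have hv' : v ∈ x' :: N := List.mem_of_getLast? hv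
        exact hold₂ v (hltN v hv') (huN v hv') (hxN v hv') (hN₂.last v hv)
    · simp only [List.mem_cons, forall_eq_or_imp]
      refine ⟨⟨by simp, hY₂.chain, by simpa using ⟨B, huw₂⟩, ?_⟩, ?_⟩
      · intro v hv
        have hv' : v ∈ u' :: Y := by
          rw [List.getLast?_cons_cons] at hv
          exact List.mem_of_getLast? hv
        exact hold₂ v (hltY v (List.mem_cons_of_mem _ hv')) (huY v hv')
          (hxY v (List.mem_cons_of_mem _ hv')) (hY₂.last v hv)
      · intro D hD
        refine (h.half D hD).mono hb₂ hrr fun v hv => ?_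
        exact hold₂ v (hltD D hD v hv) (huD D hD v hv) (hxD D hD v hv)
    · simpa using hlw
    · exact fun v hv => (h.head v hv).mono hrr
    · simpa using h.redLoses_half hrr (hiso (i := B) le_rfl) hu huw₂
    · simp [Affordable, stockSize] at hn hfin ⊢
      omega
  -- `Y` and `M` are joined through `u`, now interior, and `B` goes to `C`: three rounds, paid by
  -- `14 + 16`.
  · refine PathWins.forced_edges (pushEdges B C)
      (h.redLoses_push hrr₁ hu (hiso le_rfl) huw.symm) (by simp)
      fun b₃ hb₃ hadj₃ => ?_
    have hb := hb₂.trans hb₃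
    have h₃ := h.mono_blue hb
    have hpush := isChain_push h₃.chain hadj₃
    obtain ⟨hnd, hlt⟩ := nodup_and_lt_of_perm (l' := [B])
      (B' := B + 1) (L := [(x :: x₂ :: M).reverse ++ u :: u' :: Y, x' :: N].flatten ++ Ds.flatten ++
        [] ++ (B :: C)) h.nodup h.lt (by simp) (by simp) (by omega) (by
        intro a
        simp [List.count_cons]
        ring)
    have hY₃ := h₃.iso (u :: u' :: Y) (by simp)
    have hM₃ := h₃.iso (x :: x₂ :: M) (by simp)
    refine ih _ ?_ r₁ b₃ (B + 1) [(x :: x₂ :: M).reverse ++ u :: u' :: Y, x' :: N] Ds [] (B :: C)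
      ⟨hnd, hlt, hlt₁, ?_, ?_, by simp, hpush, ?_⟩
      ⟨hDs, Or.inr ⟨_, _, rfl, by simp; omega, rfl⟩⟩ ?_
    · omega
    · simp only [List.mem_cons, List.not_mem_nil, or_false, forall_eq_or_imp, forall_eq]
      constructor
      · refine isoPath_reverse_append (by simp) (by simp) hM₃.chain hY₃.chain ?_ ?_
          (by simpa using hb₃ hadj₂)
        · intro v hv
          have hv' := List.mem_of_getLast? hv
          exact hold₁ v (hltM v hv') (huM v hv') (hM₃.last v hv)
        · intro v hv
          have hv' : v ∈ u' :: Y := by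
            rw [List.getLast?_cons_cons] at hv
            exact List.mem_of_getLast? hv
          exact hold₁ v (hltY v (List.mem_cons_of_mem _ hv')) (huY v hv') (hY₃.last v hv)
      · exact hNi.mono hb fun v hv => hold₁ v (hltN v hv) (huN v hv)
    · intro D hD
      refine (h.half D hD).mono hb hrr₁ fun v hv => ?_
      exact hold₁ v (hltD D hD v hv) (huD D hD v hv)
    · simpa using ⟨u, huw.symm⟩
    · simp [Affordable, stockSize] at hn hfin ⊢
      omega

/-- With two open paths Builder can use the end `x` of `M` as a leaf of the star at `B`; if that
edge is blue, it lengthens `M` instead. -/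
theorem StockWins.of_double {ℓ n : ℕ} (ih : ∀ k < n, StockWins ℓ k) {r b : SimpleGraph ℕ} {B : ℕ}
    {M N : List ℕ} {Ds : List (List ℕ)} {C : List ℕ} (h : Stock r b B [M, N] Ds [] C)
    (hM : 2 ≤ M.length) (hDs : Ds.length ≤ 1)
    (hn : Affordable ℓ n [M, N] Ds [] C) (hsize : stockSize [M, N] Ds [] C < ℓ) :
    PathWins ℓ n r b := by
  obtain ⟨k, rfl⟩ : ∃ k, n = k + 10 := by
    simp [Affordable] at hn
    exact ⟨n - 10, by omega⟩
  simp [Affordable, stockSize] at hn hsize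
  have hMi := h.iso M (by simp)
  have hNi := h.iso N (by simp)
  obtain ⟨x, M, rfl⟩ := List.exists_cons_of_ne_nil hMi.ne_nil
  obtain ⟨x', N, rfl⟩ := List.exists_cons_of_ne_nil hNi.ne_nil
  obtain ⟨x₂, M, rfl⟩ : ∃ x₂ M', M = x₂ :: M' := by
    cases M with
    | nil => simp at hM
    | cons x₂ M => exact ⟨x₂, M, rfl⟩
  have hnd : ((x :: x₂ :: M) ++ ((x' :: N) ++ Ds.flatten)).Nodup := by
    simpa using (List.nodup_append.1 (List.nodup_append.1 h.nodup).1).1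
  have hlt : ∀ v ∈ (x :: x₂ :: M) ++ ((x' :: N) ++ Ds.flatten), v < B :=
    fun v hv => h.lt v (List.mem_append_left _ (List.mem_append_left _ (by simpa using hv)))
  have hltM : ∀ v ∈ x :: x₂ :: M, v < B := fun v hv => hlt v (List.mem_append_left _ hv)
  have hltN : ∀ v ∈ x' :: N, v < B := fun v hv =>
    hlt v (List.mem_append_right _ (List.mem_append_left _ hv))
  have hDmem : ∀ D ∈ Ds, ∀ v ∈ D, v ∈ Ds.flatten := fun D hD v hv =>
    List.mem_flatten.2 ⟨D, hD, hv⟩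
  have hltD : ∀ D ∈ Ds, ∀ v ∈ D, v < B := fun D hD v hv =>
    hlt v (List.mem_append_right _ (List.mem_append_right _ (hDmem D hD v hv)))
  have hxR := (List.nodup_cons.1 hnd).1
  have hxM : ∀ v ∈ x₂ :: M, v ≠ x := fun v hv =>
    ne_of_mem_of_not_mem (List.mem_append_left _ hv) hxR
  have hxN : ∀ v ∈ x' :: N, v ≠ x := fun v hv =>
    ne_of_mem_of_not_mem (List.mem_append_right _ (List.mem_append_left _ hv)) hxR
  have hxD : ∀ D ∈ Ds, ∀ v ∈ D, v ≠ x := fun D hD v hv =>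
    ne_of_mem_of_not_mem (List.mem_append_right _ (List.mem_append_right _ (hDmem D hD v hv))) hxR
  have hiso : ∀ {i}, B ≤ i → RedIsolated r i := fun hi => h.isolated hi
  have hx : RedIsolated r x := hMi.head x (by simp)
  have hx' : RedIsolated r x' := hNi.head x' (by simp)
  have hxB : x < B := hltM x (by simp)
  refine PathWins.step (u := B) (v := B + 1) (by omega) ?_ fun b₁ hb₁ hadj₁ => ?_
  swap
  · have h₁ := h.mono_blue hb₁
    obtain ⟨hnd, hlt⟩ := nodup_and_lt_of_perm (l' := [B, B + 1]) (B' := B + 2)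
      (L := [[B, B + 1], x :: x₂ :: M, x' :: N].flatten ++ Ds.flatten ++ [] ++ C)
      h.nodup h.lt (by simp) (by simp) (by omega) (by
        intro a
        simp [List.count_cons]
        ring)
    refine StockWins.of_growing (fun j hj => ih j (by omega)) (B := B + 2) (Y := [B, B + 1])
      (M := x :: x₂ :: M) (N := x' :: N) (Ds := Ds) (C := C) ⟨hnd, hlt,
        fun u v huv => (h.red_lt u v huv).trans (by omega), ?_, h₁.half, by simp, h₁.chain,
        h.head⟩ (by simp) (by simp) hDs ?_ ?_
    · simp only [List.mem_cons, List.not_mem_nil, or_false, forall_eq_or_imp, forall_eq]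
      exact ⟨⟨by simp, by simpa using hadj₁, by simpa using hiso le_rfl,
        by simpa using hiso (by omega)⟩, h₁.iso _ (by simp), h₁.iso _ (by simp)⟩
    · simp [stockSize] at hn ⊢
      omega
    · simp [stockSize] at hsize ⊢
      omega
  set r₁ := r ⊔ edge B (B + 1) with hr₁
  have hrr₁ : r ≤ r₁ := le_sup_left
  have hab : r₁.Adj B (B + 1) := sup_edge_adj_right (by omega)
  have hlt₁ := sup_edge_lt (B' := B + 2) h.red_lt (by omega) (show B < B + 2 by omega)
    (show B + 1 < B + 2 by omega)
  have hold₁ : ∀ v, v < B → RedIsolated r v → RedIsolated r₁ v := fun v hv =>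
    redIsolated_sup_edge_of_lt le_rfl (by omega) hv
  refine PathWins.step (u := x) (v := B) (by omega) ?_ fun b₂ hb₂ hadj₂ => ?_
  -- Leaf `x` joins `M` to `N`, `B + 1` stays as a spare leaf, and `B` goes to `C`: four rounds,
  -- paid by `28 + 16 - 4`.
  · set r₂ := r₁ ⊔ edge x B with hr₂
    have hrr₂ : r₁ ≤ r₂ := le_sup_left
    have hrr := hrr₁.trans hrr₂
    have hab₂ : r₂.Adj B (B + 1) := hrr₂ hab
    have hxa₂ : r₂.Adj x B := sup_edge_adj_right (by omega)
    have hlt₂ := sup_edge_lt (B' := B + 2) hlt₁ (by omega) (show x < B + 2 by omega)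
      (show B < B + 2 by omega)
    have hold₂ : ∀ v, v < B → v ≠ x → RedIsolated r v → RedIsolated r₂ v :=
      fun v hv hvx hvi => (hold₁ v hv hvi).sup_edge hvx (by omega)
    have hlx : RedLeaf r₂ x := ⟨B, B + 1, hxa₂, hab₂, by omega⟩
    have hlb : RedLeaf r₂ (B + 1) := ⟨B, x, hab₂.symm, hxa₂.symm, by omega⟩
    refine PathWins.forced_edges ((x, x') :: pushEdges B C) ?_ (by simp)
      fun b₂ hb₂ hadj₂ => ?_
    · intro e he
      rcases List.mem_cons.1 he with rfl | he
      · exact hlx.redLoses (hold₂ x' (hltN x' (by simp)) (hxN x' (by simp)) hx')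
      · exact h.redLoses_push hrr (hiso (i := B + 1) (by omega)) (hiso le_rfl) hab₂ e he
    have h₂ := h.mono_blue hb₂
    have hpush := isChain_push h₂.chain fun e he => hadj₂ e (List.mem_cons_of_mem _ he)
    obtain ⟨hnd, hlt⟩ := nodup_and_lt_of_perm (l' := [B, B + 1]) (B' := B + 2)
      (L := [(x :: x₂ :: M).reverse ++ x' :: N].flatten ++ Ds.flatten ++ [B + 1] ++ (B :: C))
      h.nodup h.lt (by simp) (by simp) (by omega) (by
        intro a
        simp [List.count_cons]
        ring)
    have hM₂ := h₂.iso (x :: x₂ :: M) (by simp)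
    have hN₂ := h₂.iso (x' :: N) (by simp)
    refine ih _ (by omega) r₂ b₂ (B + 2) [(x :: x₂ :: M).reverse ++ x' :: N] Ds [B + 1] (B :: C)
      ⟨hnd, hlt, hlt₂, ?_, ?_, by simpa using hlb, hpush, by simpa using ⟨B + 1, hab₂⟩⟩
      ⟨hDs, Or.inl ⟨_, rfl, by simp⟩⟩ ?_
    · simp only [List.mem_singleton, forall_eq]
      refine isoPath_reverse_append (by simp) (by simp) hM₂.chain hN₂.chain ?_ ?_
        (by simpa using hadj₂ (x, x') (by simp))
      · intro v hv
        have hv' : v ∈ x₂ :: M := by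
          rw [List.getLast?_cons_cons] at hv
          exact List.mem_of_getLast? hv
        exact hold₂ v (hltM v (List.mem_cons_of_mem _ hv')) (hxM v hv') (hM₂.last v hv)
      · intro v hv
        have hv' : v ∈ x' :: N := List.mem_of_getLast? hv
        exact hold₂ v (hltN v hv') (hxN v hv') (hN₂.last v hv)
    · intro D hD
      refine (h.half D hD).mono hb₂ hrr fun v hv => ?_
      exact hold₂ v (hltD D hD v hv) (hxD D hD v hv)
    · simp [Affordable, stockSize] at hn hsize ⊢
      omega
  -- `M` becomes half-open with touched end `B`, and `B + 1` goes to `C`: three rounds, paid by `28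
  -- + 16 - 13 = 31`.
  · refine PathWins.forced_edges (pushEdges (B + 1) C)
      (h.redLoses_push hrr₁ (hiso le_rfl) (hiso (by omega)) hab.symm) (by simp)
      fun b₃ hb₃ hadj₃ => ?_
    have hb := hb₂.trans hb₃
    have h₃ := h.mono_blue hb
    have hpush := isChain_push h₃.chain hadj₃
    obtain ⟨hnd, hlt⟩ := nodup_and_lt_of_perm (l' := [B, B + 1])
      (B' := B + 2) (L := [x' :: N].flatten ++ ((B :: x :: x₂ :: M) :: Ds).flatten ++
        [] ++ ((B + 1) :: C)) h.nodup h.lt (by simp) (by simp) (by omega) (by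
        intro a
        simp [List.count_cons]
        ring)
    have hM₃ := h₃.iso (x :: x₂ :: M) (by simp)
    refine PathWins.add_halfPath (B := B + 2) (M := x' :: N) (Q := B :: x :: x₂ :: M) (Ds := Ds)
      (F := []) (C := (B + 1) :: C) (fun j hj => ih j (hj.trans_lt (by omega)))
      ⟨hnd, hlt, hlt₁, ?_, ?_, by simp, hpush, by simpa using ⟨B, hab.symm⟩⟩ ?_ hDs (by simp) ?_
    · simp only [List.mem_singleton, forall_eq]
      exact hNi.mono hb fun v hv => hold₁ v (hltN v hv)
    · simp only [List.mem_cons, forall_eq_or_imp]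
      refine ⟨⟨by simp, ?_, by simpa using ⟨B + 1, hab⟩, ?_⟩, ?_⟩
      · rw [List.isChain_cons_cons]
        exact ⟨hb₃ hadj₂.symm, hM₃.chain⟩
      · intro v hv
        rw [List.getLast?_cons_cons] at hv
        have hv' := List.mem_of_getLast? hv
        exact hold₁ v (hltM v hv') (hM₃.last v hv)
      · intro D hD
        refine (h.half D hD).mono hb hrr₁ fun v hv => ?_
        exact hold₁ v (hltD D hD v hv)
    · simpa using h.redLoses_half hrr₁ (hiso (i := B + 1) (by omega)) (hiso le_rfl) hab
    · simp [Affordable, stockSize] at hn hsize ⊢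
      omega

/-! ### Conclusion of the upper bound and the theorem. -/

theorem stockWins (ℓ n : ℕ) : StockWins ℓ n := by
  induction n using Nat.strong_induction_on with
  | _ n ih =>
  intro r b B Ms Ds F C h hnormal hn
  obtain ⟨hDs, hMs⟩ := hnormal
  by_cases hfin : stockSize Ms Ds F C < ℓ
  · rcases hMs with ⟨M, rfl, hF⟩ | ⟨M, N, rfl, hM, rfl⟩
    · exact StockWins.of_single ih h hDs hF hn hfin
    · exact StockWins.of_double ih h hM hDs hn hfin
  · have hlen : (Ms.length = 1 ∧ F.length ≤ 1) ∨ (Ms.length = 2 ∧ F.length = 0) := by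
      rcases hMs with ⟨M, rfl, hF⟩ | ⟨M, N, rfl, hM, rfl⟩
      · exact Or.inl ⟨rfl, hF⟩
      · exact Or.inr ⟨rfl, rfl⟩
    obtain ⟨hn, hsize⟩ := hn
    refine PathWins.of_stock h (by omega) ?_
    clear hMs ih h
    generalize stockSize Ms Ds F C = W at *
    omega

/-- The initial stock is a single vertex, so the potential asks for `14(ℓ + 1) + 16 + 80 ≤ 10n +
14`. -/
theorem pathWins_bot {ℓ n : ℕ} (hn : 7 * ℓ + 48 ≤ 5 * n) : PathWins ℓ n ⊥ ⊥ := by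
  refine stockWins ℓ n ⊥ ⊥ 1 [[0]] [] [] [] ?_ ⟨by simp, Or.inl ⟨_, rfl, by simp⟩⟩ ?_
  · refine ⟨by simp, by simp, by simp, ?_, by simp, by simp, by simp, by simp⟩
    simp only [List.mem_singleton, forall_eq]
    exact ⟨by simp, by simp, fun v _ w hw => hw, fun v _ w hw => hw⟩
  · simp [Affordable, stockSize]
    omega

end OnlineRamsey

theorem theorem1p6 (ℓ : ℕ) (hℓ : 3 ≤ ℓ) :
    ∃ r : ℕ,
      OnlineRamsey.onlineRamseyNumber (SimpleGraph.pathGraph 4) (SimpleGraph.pathGraph (ℓ + 1))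
        = (r : ℕ∞) ∧
      (7 * (ℓ : ℝ) + 2) / 5 ≤ (r : ℝ) ∧ (r : ℝ) ≤ (7 * (ℓ : ℝ) + 52) / 5 := by
  classical
  have hupper : OnlineRamsey.BuilderWinsWithin (SimpleGraph.pathGraph 4)
      -- Natural division loses at most 4 in the numerator, which is why 48 becomes 52.
      (SimpleGraph.pathGraph (ℓ + 1)) ((7 * ℓ + 52) / 5) OnlineRamsey.Position.start :=
    OnlineRamsey.pathWins_bot (by omega)
  have hex : ∃ n, OnlineRamsey.BuilderWinsWithin (SimpleGraph.pathGraph 4)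
      (SimpleGraph.pathGraph (ℓ + 1)) n OnlineRamsey.Position.start := ⟨_, hupper⟩
  refine ⟨Nat.find hex, le_antisymm (iInf₂_le (Nat.find hex) (Nat.find_spec hex)) ?_, ?_, ?_⟩
  · exact le_iInf₂ fun n hn => by exact_mod_cast Nat.find_min' hex hn
  · have h := OnlineRamsey.seven_mul_add_two_le (by omega) (Nat.find_spec hex)
    rw [div_le_iff₀ (by norm_num)]
    have h' : (7 * (ℓ : ℝ) + 2) ≤ 5 * (Nat.find hex : ℝ) := by exact_mod_cast h
    linarith
  · have h : 5 * Nat.find hex ≤ 7 * ℓ + 52 := by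
      have := Nat.find_min' hex hupper
      omega
    rw [le_div_iff₀ (by norm_num)]
    have h' : 5 * (Nat.find hex : ℝ) ≤ 7 * (ℓ : ℝ) + 52 := by exact_mod_cast h
    linarith
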